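/- All curves are smooth ($C^\infty$) curves in the plane $\mathbb{R}^2$ with its standard area form $|\cdot,\cdot|$. For a closed curve $c$ in a parameter $u$ with $|\dot c,\ddot c|>0$, the equi-affine arc-length is $\mathrm{d}s=|\dot c,\ddot c|^{1/3}\,\mathrm{d}u$, and a prime denotes $\mathrm{d}/\mathrm{d}s$. The equi-affine curvature $\kappa$ is defined by $c'''=-\kappa\,c'$ (equivalently, $\kappa=|c'',c'''|$, since $|c',c''|=1$), and $\mathrm{Area}=\frac12\oint|c,\mathrm{d}c|$ is the enclosed area. The curve is strictly positively curved if $\kappa>0$ everywhere. Let $\gamma$ be a simple closed strictly positively curved curve, parametrised by equi-affine arc-length. A deformation of $\gamma$ is a smooth one-parameter family $(\gamma_t)_{|t|<\varepsilon}$ of closed strictly positively curved curves (parametrised on the same circle, with $|\dot\gamma_t,\ddot\gamma_t|>0$) such that $\gamma_0=\gamma$. The curve $\gamma$ is a critical point of $\int\sqrt{\kappa}\,\mathrm{d}s$ if $\frac{\mathrm{d}}{\mathrm{d}t}\big|_{t=0}\int\sqrt{\kappa_t}\,\mathrm{d}s_t=0$ for every deformation. It is a critical point under the constraint $G$, where $G$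 is a functional, if this holds for every deformation with $G(\gamma_t)=G(\gamma)$ for all $t$. An ellipse is the image of the unit circle under an invertible affine map. **Theorem.** Every ellipse is the trace of a simple closed strictly positively curved curve. For a simple closed strictly positively curved curve $\gamma$: (i) $\gamma$ is a critical point of $\int\sqrt{\kappa}\,\mathrm{d}s$ if and only if its trace is an ellipse; (ii) $\gamma$ is a critical point of $\int\sqrt{\kappa}\,\mathrm{d}s$ under the area constraint ($G=\mathrm{Area}$) if and only if its trace is an ellipse; (iii) $\gamma$ is a critical point of $\int\sqrt{\kappa}\,\mathrm{d}s$ under the equi-affine arc-length constraint ($G=\int\mathrm{d}s$) if and only if its trace is an ellipse; (iv) $\gamma$ is a critical point of $\int\sqrt{\kappa}\,\mathrm{d}s$ under the total equi-affine curvature constraint ($G=\int\kappa\,\mathrm{d}s$) if and only if its trace is an ellipse. -/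

import Mathlib

open Set
open scoped ContDiff

noncomputable section

/-- The plane, with its standard area form `areaForm`. -/
abbrev Plane : Type := ℝ × ℝ

/-- The area form `|v, w|`. -/
def areaForm (v w : Plane) : ℝ := v.1 * w.2 - v.2 * w.1

/-- The density `ds/du = |c', c''|^(1/3)` of the equi-affine arc-length `s` of a curve `c` in an
arbitrary parameter `u`, for `|c', c''| > 0`. -/
def affineSpeed (c : ℝ → Plane) (u : ℝ) : ℝ :=
  (areaForm (deriv c u) (deriv (deriv c) u)) ^ (1 / 3 : ℝ)

/-- The derivative `dh/ds` of a vector field `h` along `c` with respect to the equi-affine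
arc-length of `c`. -/
def arcDeriv (c h : ℝ → Plane) (u : ℝ) : Plane := (affineSpeed c u)⁻¹ • deriv h u

/-- The equi-affine tangent `T = dc/ds`. -/
def affineTangent (c : ℝ → Plane) : ℝ → Plane := arcDeriv c c

/-- The Blaschke normal `N = dT/ds`. -/
def affineNormal (c : ℝ → Plane) : ℝ → Plane := arcDeriv c (affineTangent c)

/-- The equi-affine curvature `κ`. As `|T, N| = 1`, the equation `dN/ds = -κ T` says precisely
that `κ = |N, dN/ds|` (see `affineCurvature_eq_of_eq`). -/
def affineCurvature (c : ℝ → Plane) (u : ℝ) : ℝ :=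
  areaForm (affineNormal c u) (arcDeriv c (affineNormal c) u)

/-- If `|T, N| = 1` and `dN/ds = -k T`, then `k` is the equi-affine curvature. -/
theorem affineCurvature_eq_of_eq (c : ℝ → Plane) (u k : ℝ)
    (h1 : areaForm (affineTangent c u) (affineNormal c u) = 1)
    (h2 : arcDeriv c (affineNormal c) u = -(k • affineTangent c u)) :
    affineCurvature c u = k := by
  unfold affineCurvature
  rw [h2]
  simp only [areaForm, Prod.fst_neg, Prod.snd_neg, Prod.smul_fst, Prod.smul_snd,
    smul_eq_mul] at h1 ⊢
  linear_combination k * h1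

/-- The equi-affine arc-length `∫ ds` of a closed curve with period `L`. -/
def affineLength (c : ℝ → Plane) (L : ℝ) : ℝ := ∫ u in (0 : ℝ)..L, affineSpeed c u

/-- The total equi-affine curvature `∫ κ ds`. -/
def totalAffineCurvature (c : ℝ → Plane) (L : ℝ) : ℝ :=
  ∫ u in (0 : ℝ)..L, affineCurvature c u * affineSpeed c u

/-- The functional `∫ √κ ds`. -/
def fullAffineLength (c : ℝ → Plane) (L : ℝ) : ℝ :=
  ∫ u in (0 : ℝ)..L, Real.sqrt (affineCurvature c u) * affineSpeed c u

/-- The area `(1/2) ∮ |c, dc|` enclosed by a positively oriented closed curve with period `L`. -/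
def enclosedArea (c : ℝ → Plane) (L : ℝ) : ℝ :=
  (1 / 2) * ∫ u in (0 : ℝ)..L, areaForm (c u) (deriv c u)

/-- `γ` is a smooth simple closed curve, parametrised by equi-affine arc-length with period `L`
(so that `L` is its equi-affine length), with strictly positive equi-affine curvature. -/
structure IsSimpleClosedPositivelyCurved (γ : ℝ → Plane) (L : ℝ) : Prop where
  period_pos : 0 < L
  smooth : ContDiff ℝ ∞ γ
  closed : Function.Periodic γ L
  simple : InjOn γ (Ico 0 L)
  arcLength : ∀ s, areaForm (deriv γ s) (deriv (deriv γ) s) = 1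
  curvature_pos : ∀ s, 0 < affineCurvature γ s

/-- `Γ t`, `|t| < ε`, is a smooth deformation of `γ` through strictly positively curved closed
curves. The curves `Γ t` with `t ≠ 0` need not be parametrised by equi-affine arc-length. -/
structure IsDeformation (γ : ℝ → Plane) (L ε : ℝ) (Γ : ℝ → ℝ → Plane) : Prop where
  smooth : ContDiffOn ℝ ∞ (fun p : ℝ × ℝ => Γ p.1 p.2) (Ioo (-ε) ε ×ˢ univ)
  start : Γ 0 = γ
  closed : ∀ t ∈ Ioo (-ε) ε, Function.Periodic (Γ t) L
  nondegenerate : ∀ t ∈ Ioo (-ε) ε, ∀ u,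
    0 < areaForm (deriv (Γ t) u) (deriv (deriv (Γ t)) u)
  curvature_pos : ∀ t ∈ Ioo (-ε) ε, ∀ u, 0 < affineCurvature (Γ t) u

/-- `γ` is a critical point of the functional `F`: the first variation of `F` vanishes under every
deformation of `γ`. -/
def IsCriticalPoint (F : (ℝ → Plane) → ℝ → ℝ) (γ : ℝ → Plane) (L : ℝ) : Prop :=
  ∀ (ε : ℝ) (Γ : ℝ → ℝ → Plane), 0 < ε → IsDeformation γ L ε Γ →
    HasDerivAt (fun t => F (Γ t) L) 0 0

/-- `γ` is a critical point of `F` under the constraint `G`: the first variation of `F` vanishes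
under every deformation of `γ` that preserves the value of `G`. -/
def IsCriticalPointUnder (F G : (ℝ → Plane) → ℝ → ℝ) (γ : ℝ → Plane) (L : ℝ) : Prop :=
  ∀ (ε : ℝ) (Γ : ℝ → ℝ → Plane), 0 < ε → IsDeformation γ L ε Γ →
    (∀ t ∈ Ioo (-ε) ε, G (Γ t) L = G γ L) →
    HasDerivAt (fun t => F (Γ t) L) 0 0

/-- An ellipse: the image of the unit circle under an invertible affine map of the plane. -/
def IsEllipse (E : Set Plane) : Prop :=
  ∃ φ : Plane ≃ᵃ[ℝ] Plane, E = φ '' {v : Plane | v.1 ^ 2 + v.2 ^ 2 = 1}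

end

/-! In an arbitrary parameter the integrand of `fullAffineLength` is the square root of `densitySq`,
a rational function of the first four derivatives of the curve
(`affineCurvature_mul_affineSpeed_sq`). The first variation is therefore an explicit integral,
linear in the variation field `V` (`IsDeformation.exists_hasDerivAt_fullAffineLength`).

If `κ` is constant, this integrand is an exact derivative of a periodic function, so the curve is
critical (`isCriticalPoint_of_affineCurvature_const`). Conversely, put `g = κ^(-1/2)` and vary along
`V = g² γ''`. Up to an exact derivative the integrand is then `g g''² / 3`, which is nonnegative.
Criticality forces `g'' = 0`, and a periodic `g` with `g'' = 0` is constant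
(`affineCurvature_const_of_hasDerivAt_zero`). Constant positive curvature characterises ellipses:
the equation `γ''' = -κ γ'` then integrates to trigonometric functions, and conversely a point of
the unit circle moving with constant `|c', c''|` moves uniformly.

The constraints cost nothing. The functional is invariant under homotheties, while area, equi-affine
length and total curvature are homogeneous of degrees `2`, `2/3` and `-2/3`. Rescaling each curve of
a deformation restores the constraint without changing the functional, provided that the constraint
is nonzero on `γ` (`IsCriticalPointUnder.hasDerivAt_zero`). For length and total curvature this is
immediate. For the area it is where simplicity enters: a closed locally convex curve of turning
number at least `2` crosses itself, so `γ` has turning number `1`, lies to the left of each of its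
tangents, and encloses positive area (`enclosedArea_pos`). -/

/-! ### Calculus of functions of two variables on a strip -/

/-- The partial derivative of `f` in its first variable. -/
noncomputable def partialFst {E : Type*} [NormedAddCommGroup E] [NormedSpace ℝ E]
    (f : ℝ × ℝ → E) : ℝ × ℝ → E := fun p => fderiv ℝ f p (1, 0)

/-- The partial derivative of `f` in its second variable. -/
noncomputable def partialSnd {E : Type*} [NormedAddCommGroup E] [NormedSpace ℝ E]
    (f : ℝ × ℝ → E) : ℝ × ℝ → E := fun p => fderiv ℝ f p (0, 1)

section strip

variable {E : Type*} [NormedAddCommGroup E] [NormedSpace ℝ E] {f g : ℝ × ℝ → E}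
  {U : Set (ℝ × ℝ)}

theorem contDiffOn_fderiv_apply (hU : IsOpen U) (hf : ContDiffOn ℝ ∞ f U) (v : ℝ × ℝ) :
    ContDiffOn ℝ ∞ (fun p => fderiv ℝ f p v) U :=
  (hf.fderiv_of_isOpen hU (m := ∞) (by simp)).clm_apply contDiffOn_const

theorem contDiffOn_partialFst (hU : IsOpen U) (hf : ContDiffOn ℝ ∞ f U) :
    ContDiffOn ℝ ∞ (partialFst f) U := contDiffOn_fderiv_apply hU hf _

theorem contDiffOn_partialSnd (hU : IsOpen U) (hf : ContDiffOn ℝ ∞ f U) :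
    ContDiffOn ℝ ∞ (partialSnd f) U := contDiffOn_fderiv_apply hU hf _

theorem contDiffOn_iterate_partialSnd (hU : IsOpen U) (hf : ContDiffOn ℝ ∞ f U) (k : ℕ) :
    ContDiffOn ℝ ∞ (partialSnd^[k] f) U := by
  induction k with
  | zero => exact hf
  | succ k ih => rw [Function.iterate_succ_apply']; exact contDiffOn_partialSnd hU ih

theorem differentiableAt_of_contDiffOn (hU : IsOpen U) (hf : ContDiffOn ℝ ∞ f U) {p : ℝ × ℝ}
    (hp : p ∈ U) : DifferentiableAt ℝ f p :=
  (hf.contDiffAt (hU.mem_nhds hp)).differentiableAt (by simp)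

theorem hasDerivAt_partialFst (hU : IsOpen U) (hf : ContDiffOn ℝ ∞ f U) {t u : ℝ}
    (hp : (t, u) ∈ U) : HasDerivAt (fun s => f (s, u)) (partialFst f (t, u)) t :=
  (differentiableAt_of_contDiffOn hU hf hp).hasFDerivAt.comp_hasDerivAt (f := fun s => (s, u)) t
    ((hasDerivAt_id t).prodMk (hasDerivAt_const t u))

theorem hasDerivAt_partialSnd (hU : IsOpen U) (hf : ContDiffOn ℝ ∞ f U) {t u : ℝ}
    (hp : (t, u) ∈ U) : HasDerivAt (fun v => f (t, v)) (partialSnd f (t, u)) u :=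
  (differentiableAt_of_contDiffOn hU hf hp).hasFDerivAt.comp_hasDerivAt (f := fun v => (t, v)) u
    ((hasDerivAt_const u t).prodMk (hasDerivAt_id u))

theorem partialFst_partialSnd (hU : IsOpen U) (hf : ContDiffOn ℝ ∞ f U) {p : ℝ × ℝ}
    (hp : p ∈ U) : partialFst (partialSnd f) p = partialSnd (partialFst f) p := by
  have hc : ContDiffAt ℝ ∞ f p := hf.contDiffAt (hU.mem_nhds hp)
  have hd : DifferentiableAt ℝ (fderiv ℝ f) p :=
    (hc.fderiv_right (m := ∞) (by simp)).differentiableAt (by simp)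
  have key : ∀ v w, fderiv ℝ (fun p => fderiv ℝ f p v) p w = fderiv ℝ (fderiv ℝ f) p w v := by
    intro v w
    rw [fderiv_clm_apply hd (differentiableAt_const v)]
    simp
  have hs : IsSymmSndFDerivAt ℝ f p := hc.isSymmSndFDerivAt (by
    rw [minSmoothness_of_isRCLikeNormedField]; exact WithTop.coe_le_coe.2 (le_top : (2 : ℕ∞) ≤ ⊤))
  change fderiv ℝ (fun p => fderiv ℝ f p (0, 1)) p (1, 0)
    = fderiv ℝ (fun p => fderiv ℝ f p (1, 0)) p (0, 1)
  rw [key, key]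
  exact hs _ _

theorem partialSnd_congr (hU : IsOpen U) (h : EqOn f g U) :
    EqOn (partialSnd f) (partialSnd g) U := fun p hp => by
  have : f =ᶠ[nhds p] g := Filter.eventuallyEq_of_mem (hU.mem_nhds hp) h
  simp only [partialSnd, this.fderiv_eq]

theorem partialFst_iterate_partialSnd (hU : IsOpen U) (hf : ContDiffOn ℝ ∞ f U) (k : ℕ) :
    EqOn (partialFst (partialSnd^[k] f)) (partialSnd^[k] (partialFst f)) U := by
  induction k with
  | zero => exact fun _ _ => rfl
  | succ k ih =>
    intro p hp
    rw [Function.iterate_succ_apply', Function.iterate_succ_apply',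
      partialFst_partialSnd hU (contDiffOn_iterate_partialSnd hU hf k) hp]
    exact partialSnd_congr hU ih hp

theorem iterate_deriv_eq_iterate_partialSnd {I : Set ℝ} (hI : IsOpen I)
    (hf : ContDiffOn ℝ ∞ f (I ×ˢ univ)) {t : ℝ} (ht : t ∈ I) (k : ℕ) :
    deriv^[k] (fun u => f (t, u)) = fun u => (partialSnd^[k] f) (t, u) := by
  have hU : IsOpen (I ×ˢ (univ : Set ℝ)) := hI.prod isOpen_univ
  induction k with
  | zero => rfl
  | succ k ih =>
    rw [Function.iterate_succ_apply', Function.iterate_succ_apply', ih]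
    funext u
    exact (hasDerivAt_partialSnd hU (contDiffOn_iterate_partialSnd hU hf k) ⟨ht, trivial⟩).deriv

theorem continuous_section {F : Type*} [TopologicalSpace F] {I : Set ℝ} {t : ℝ} (ht : t ∈ I)
    {f : ℝ × ℝ → F}
    (hf : ContinuousOn f (I ×ˢ univ)) : Continuous fun u => f (t, u) :=
  hf.comp_continuous (by fun_prop) fun _ => ⟨ht, trivial⟩

theorem contDiff_section {I : Set ℝ} {t : ℝ} (ht : t ∈ I) {f : ℝ × ℝ → E}
    (hf : ContDiffOn ℝ ∞ f (I ×ˢ univ)) : ContDiff ℝ ∞ fun u => f (t, u) :=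
  hf.comp_contDiff (by fun_prop) fun _ => ⟨ht, trivial⟩

end strip

/-! ### Differentiation under the integral sign. -/

theorem hasDerivAt_integral_partialFst {f : ℝ × ℝ → ℝ} {I : Set ℝ} (hI : IsOpen I)
    (hf : ContDiffOn ℝ ∞ f (I ×ˢ univ)) (L : ℝ) {t : ℝ} (ht : t ∈ I) :
    HasDerivAt (fun s => ∫ u in (0 : ℝ)..L, f (s, u))
      (∫ u in (0 : ℝ)..L, partialFst f (t, u)) t := by
  have hU : IsOpen (I ×ˢ (univ : Set ℝ)) := hI.prod isOpen_univ
  obtain ⟨r, hr, hrI⟩ := Metric.nhds_basis_closedBall.mem_iff.1 (hI.mem_nhds ht)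
  have hc := (contDiffOn_partialFst hU hf).continuousOn
  obtain ⟨C, hC⟩ := ((isCompact_closedBall t r).prod (isCompact_uIcc (a := (0 : ℝ)) (b := L)))
    |>.exists_bound_of_continuousOn (hc.mono (prod_mono hrI (subset_univ _)))
  refine (intervalIntegral.hasDerivAt_integral_of_dominated_loc_of_deriv_le
    (μ := MeasureTheory.volume) (F := fun s u => f (s, u)) (F' := fun s u => partialFst f (s, u))
    (bound := fun _ => C) (Metric.closedBall_mem_nhds t hr) ?_ ?_ ?_ ?_ ?_ ?_).2
  · filter_upwards [hI.mem_nhds ht] with s hs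
    exact (continuous_section hs hf.continuousOn).aestronglyMeasurable
  · exact (continuous_section ht hf.continuousOn).intervalIntegrable _ _
  · exact (continuous_section ht hc).aestronglyMeasurable
  · exact Filter.Eventually.of_forall fun u hu s hs => hC (s, u) ⟨hs, uIoc_subset_uIcc hu⟩
  · exact intervalIntegrable_const
  · exact Filter.Eventually.of_forall fun u _ s hs =>
      hasDerivAt_partialFst hU hf ⟨hrI hs, trivial⟩

/-- The derivative is again the integral of a smooth function on the strip, so induction on the
order works once the integrand is generalised. -/
theorem contDiffOn_integral {I : Set ℝ} (hI : IsOpen I) (L : ℝ) {f : ℝ × ℝ → ℝ}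
    (hf : ContDiffOn ℝ ∞ f (I ×ˢ univ)) :
    ContDiffOn ℝ ∞ (fun s => ∫ u in (0 : ℝ)..L, f (s, u)) I := by
  have hU : IsOpen (I ×ˢ (univ : Set ℝ)) := hI.prod isOpen_univ
  refine contDiffOn_infty.2 fun n => ?_
  induction n generalizing f with
  | zero =>
    exact contDiffOn_zero.2 fun t ht =>
      (hasDerivAt_integral_partialFst hI hf L ht).continuousAt.continuousWithinAt
  | succ n ih =>
    refine (contDiffOn_succ_iff_deriv_of_isOpen hI).2 ⟨fun t ht =>
      (hasDerivAt_integral_partialFst hI hf L ht).differentiableAt.differentiableWithinAt,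
      by simp, (ih (contDiffOn_partialFst hU hf)).congr fun t ht =>
        (hasDerivAt_integral_partialFst hI hf L ht).deriv⟩

/-! ### The area form and the equi-affine curvature in an arbitrary parameter -/

theorem HasDerivAt.areaForm {a b : ℝ → Plane} {a' b' : Plane} {u : ℝ} (ha : HasDerivAt a a' u)
    (hb : HasDerivAt b b' u) :
    HasDerivAt (fun v => areaForm (a v) (b v)) (areaForm a' (b u) + areaForm (a u) b') u := by
  have a1 : HasDerivAt (fun v => (a v).1) a'.1 u := 
    (ContinuousLinearMap.fst ℝ ℝ ℝ).hasFDerivAt.comp_hasDerivAt u ha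
  have a2 : HasDerivAt (fun v => (a v).2) a'.2 u := 
    (ContinuousLinearMap.snd ℝ ℝ ℝ).hasFDerivAt.comp_hasDerivAt u ha
  have b1 : HasDerivAt (fun v => (b v).1) b'.1 u := 
    (ContinuousLinearMap.fst ℝ ℝ ℝ).hasFDerivAt.comp_hasDerivAt u hb
  have b2 : HasDerivAt (fun v => (b v).2) b'.2 u := 
    (ContinuousLinearMap.snd ℝ ℝ ℝ).hasFDerivAt.comp_hasDerivAt u hb
  have h := (a1.mul b2).sub (a2.mul b1)
  refine h.congr_deriv ?_
  simp only [_root_.areaForm]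
  ring

theorem ContDiffOn.areaForm {E : Type*} [NormedAddCommGroup E] [NormedSpace ℝ E]
    {a b : E → Plane} {n : WithTop ℕ∞} {s : Set E} (ha : ContDiffOn ℝ n a s)
    (hb : ContDiffOn ℝ n b s) : ContDiffOn ℝ n (fun v => areaForm (a v) (b v)) s :=
  (ha.fst.mul hb.snd).sub (ha.snd.mul hb.fst)

theorem ContDiff.areaForm {E : Type*} [NormedAddCommGroup E] [NormedSpace ℝ E]
    {a b : E → Plane} {n : WithTop ℕ∞} (ha : ContDiff ℝ n a)
    (hb : ContDiff ℝ n b) : ContDiff ℝ n (fun v => areaForm (a v) (b v)) :=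
  (ha.fst.mul hb.snd).sub (ha.snd.mul hb.fst)

theorem areaForm_smul_smul (x y : ℝ) (v w : Plane) :
    areaForm (x • v) (y • w) = x * y * areaForm v w := by
  simp only [areaForm, Prod.smul_fst, Prod.smul_snd, smul_eq_mul]
  ring

theorem areaForm_self (v : Plane) : areaForm v v = 0 := by
  simp only [areaForm]; ring

theorem areaForm_swap (v w : Plane) : areaForm w v = -areaForm v w := by
  simp only [areaForm]; ring

theorem areaForm_add_left (v w x : Plane) : areaForm (v + w) x = areaForm v x + areaForm w x := by
  simp only [areaForm, Prod.fst_add, Prod.snd_add]; ring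

theorem areaForm_add_right (v w x : Plane) : areaForm x (v + w) = areaForm x v + areaForm x w := by
  simp only [areaForm, Prod.fst_add, Prod.snd_add]; ring

theorem areaForm_smul_left (k : ℝ) (v w : Plane) : areaForm (k • v) w = k * areaForm v w := by
  simp only [areaForm, Prod.smul_fst, Prod.smul_snd, smul_eq_mul]; ring

theorem areaForm_smul_right (k : ℝ) (v w : Plane) : areaForm v (k • w) = k * areaForm v w := by
  simp only [areaForm, Prod.smul_fst, Prod.smul_snd, smul_eq_mul]; ring

theorem areaForm_neg_left (v w : Plane) : areaForm (-v) w = -areaForm v w := by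
  simp only [areaForm, Prod.fst_neg, Prod.snd_neg]; ring

theorem areaForm_neg_right (v w : Plane) : areaForm v (-w) = -areaForm v w := by
  simp only [areaForm, Prod.fst_neg, Prod.snd_neg]; ring

theorem ContDiff.hasDerivAt_iterate_deriv {E : Type*} [NormedAddCommGroup E] [NormedSpace ℝ E]
    {c : ℝ → E} (hc : ContDiff ℝ ∞ c) (k : ℕ) (u : ℝ) :
    HasDerivAt (deriv^[k] c) ((deriv^[k + 1] c) u) u := by
  rw [Function.iterate_succ_apply']
  exact ((hc.iterate_deriv k).differentiable (by simp) u).hasDerivAt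

/-- The square of the density of `∫ √κ ds` in an arbitrary parameter, as a function of the first
four derivatives of the curve. -/
noncomputable def densitySq (c₁ c₂ c₃ c₄ : Plane) : ℝ :=
  (4 * areaForm c₂ c₃ + areaForm c₁ c₄) / (3 * areaForm c₁ c₂)
    - 5 * areaForm c₁ c₃ ^ 2 / (9 * areaForm c₁ c₂ ^ 2)

/-- Each quotient has numerator and denominator of equal degree. This is the source of the
invariance of `∫ √κ ds` under homotheties. -/
theorem densitySq_smul {k : ℝ} (hk : k ≠ 0) (c₁ c₂ c₃ c₄ : Plane) :
    densitySq (k • c₁) (k • c₂) (k • c₃) (k • c₄) = densitySq c₁ c₂ c₃ c₄ := by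
  simp only [densitySq, areaForm_smul_smul]
  have h1 : (4 * (k * k * areaForm c₂ c₃) + k * k * areaForm c₁ c₄) /
      (3 * (k * k * areaForm c₁ c₂)) = (k * k * (4 * areaForm c₂ c₃ + areaForm c₁ c₄)) /
      (k * k * (3 * areaForm c₁ c₂)) := by ring_nf
  have h2 : 5 * (k * k * areaForm c₁ c₃) ^ 2 / (9 * (k * k * areaForm c₁ c₂) ^ 2) =
      ((k * k) ^ 2 * (5 * areaForm c₁ c₃ ^ 2)) / ((k * k) ^ 2 * (9 * areaForm c₁ c₂ ^ 2)) := by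
    ring_nf
  rw [h1, h2, mul_div_mul_left _ _ (by positivity), mul_div_mul_left _ _ (by positivity)]

section curvature

variable {c : ℝ → Plane}

theorem affineSpeed_pos (hD : ∀ u, 0 < areaForm (deriv c u) (deriv (deriv c) u)) (u : ℝ) :
    0 < affineSpeed c u := Real.rpow_pos_of_pos (hD u) _

theorem affineSpeed_pow_three (hD : ∀ u, 0 < areaForm (deriv c u) (deriv (deriv c) u)) (u : ℝ) :
    affineSpeed c u ^ 3 = areaForm (deriv c u) (deriv (deriv c) u) := by
  rw [affineSpeed, ← Real.rpow_natCast, ← Real.rpow_mul (hD u).le]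
  norm_num

theorem contDiff_affineSpeed (hc : ContDiff ℝ ∞ c)
    (hD : ∀ u, 0 < areaForm (deriv c u) (deriv (deriv c) u)) :
    ContDiff ℝ ∞ (affineSpeed c) :=
  ((hc.iterate_deriv 1).areaForm (hc.iterate_deriv 2)).rpow_const_of_ne fun u => (hD u).ne'

/-- With `σ³ = |c', c''|`, one differentiation gives `|c', c'''| = 3σ²σ'`, and a second expresses
`σ''` through `|c'', c'''| + |c', c''''|`. Substituting these into `N = σ⁻² c'' - σ' σ⁻³ c'` and its
derivative removes all derivatives of `σ`. The factor `σ²` also removes the cube root, leaving a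
rational expression. -/
theorem affineCurvature_mul_affineSpeed_sq (hc : ContDiff ℝ ∞ c)
    (hD : ∀ u, 0 < areaForm (deriv c u) (deriv (deriv c) u)) (u : ℝ) :
    affineCurvature c u * affineSpeed c u ^ 2 =
      densitySq (deriv c u) (deriv (deriv c) u) (deriv^[3] c u) (deriv^[4] c u) := by
  set σ := affineSpeed c with hσ
  have hpos : ∀ v, 0 < σ v := affineSpeed_pos hD
  have hs : ContDiff ℝ ∞ σ := contDiff_affineSpeed hc hD
  have h0 : ∀ v, HasDerivAt σ (deriv σ v) v := hs.hasDerivAt_iterate_deriv 0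
  have h1 : ∀ v, HasDerivAt (deriv σ) (deriv^[2] σ v) v := hs.hasDerivAt_iterate_deriv 1
  have c1 : ∀ v, HasDerivAt (deriv c) (deriv^[2] c v) v := hc.hasDerivAt_iterate_deriv 1
  have c2 : ∀ v, HasDerivAt (deriv^[2] c) (deriv^[3] c v) v := hc.hasDerivAt_iterate_deriv 2
  have c3 : ∀ v, HasDerivAt (deriv^[3] c) (deriv^[4] c v) v := hc.hasDerivAt_iterate_deriv 3
  have hT : affineTangent c = fun v => (σ v)⁻¹ • deriv c v := rfl
  have hN : affineNormal c = fun v => ((σ v)⁻¹) ^ 2 • deriv^[2] c v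
      - (deriv σ v * (σ v)⁻¹ ^ 3) • deriv c v := by
    funext v
    have hd : HasDerivAt (fun v => (σ v)⁻¹ • deriv c v)
        ((σ v)⁻¹ • deriv^[2] c v + (-deriv σ v / σ v ^ 2) • deriv c v) v :=
      ((h0 v).inv (hpos v).ne').smul (c1 v)
    change (σ v)⁻¹ • deriv (affineTangent c) v = _
    rw [hT, hd.deriv]
    have := (hpos v).ne'
    ext <;> simp <;> field_simp <;> ring
  have hN' := ((((h0 u).inv (hpos u).ne').pow 2).smul (c2 u)).sub
    (((h1 u).mul (((h0 u).inv (hpos u).ne').pow 3)).smul (c1 u))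
  have hE : ∀ v, areaForm (deriv c v) (deriv^[3] c v) = 3 * (σ v ^ 2 * deriv σ v) := fun v => by
    have e1 := (c1 v).areaForm (c2 v)
    have e3 : (fun v => areaForm (deriv c v) (deriv^[2] c v)) = fun v => σ v ^ 3 :=
      funext fun v => (affineSpeed_pow_three hD v).symm
    rw [e3] at e1
    have := e1.unique ((h0 v).pow 3)
    rw [areaForm_self, zero_add] at this
    rw [this]; push_cast; ring
  have hE' : areaForm (deriv^[2] c u) (deriv^[3] c u) + areaForm (deriv c u) (deriv^[4] c u)
      = 6 * σ u * deriv σ u ^ 2 + 3 * σ u ^ 2 * deriv^[2] σ u := by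
    have e1 := (c1 u).areaForm (c3 u)
    rw [funext hE] at e1
    rw [e1.unique ((((h0 u).pow 2).mul (h1 u)).const_mul 3)]
    simp only [Pi.pow_apply]; push_cast; ring
  have hDu : areaForm (deriv c u) (deriv^[2] c u) = σ u ^ 3 := (affineSpeed_pow_three hD u).symm
  have hEu := hE u
  change areaForm (affineNormal c u) ((σ u)⁻¹ • deriv (affineNormal c) u) * _
    = densitySq (deriv c u) (deriv^[2] c u) (deriv^[3] c u) (deriv^[4] c u)
  have hNd := (congrArg (deriv · u) hN).trans hN'.deriv
  beta_reduce at hNd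
  rw [hNd, hN, densitySq, hDu, hEu, eq_sub_of_add_eq' hE']
  clear hNd hN hN' hE hE'
  have hu := (hpos u).ne'
  simp only [Pi.pow_apply, Pi.mul_apply, Pi.inv_apply]
  have e1 : areaForm (deriv^[2] c u) (deriv c u) = - σ u ^ 3 := by rw [areaForm_swap, hDu]
  simp only [sub_eq_add_neg, areaForm_add_left, areaForm_add_right, areaForm_smul_left,
    areaForm_smul_right, areaForm_neg_left, areaForm_neg_right, areaForm_self, hDu, e1, hEu]
  simp only [Nat.reduceSub, Nat.cast_ofNat, pow_one]
  field_simp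
  ring

theorem affineCurvature_pos_iff (hc : ContDiff ℝ ∞ c)
    (hD : ∀ u, 0 < areaForm (deriv c u) (deriv (deriv c) u)) (u : ℝ) :
    0 < affineCurvature c u ↔
      0 < densitySq (deriv c u) (deriv^[2] c u) (deriv^[3] c u) (deriv^[4] c u) := by
  have h := affineCurvature_mul_affineSpeed_sq hc hD u
  have h2 := pow_pos (affineSpeed_pos hD u) 2
  change _ ↔ 0 < densitySq (deriv c u) (deriv (deriv c) u) (deriv^[3] c u) (deriv^[4] c u)
  rw [← h, mul_pos_iff_of_pos_right h2]

theorem fullAffineLength_eq (hc : ContDiff ℝ ∞ c)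
    (hD : ∀ u, 0 < areaForm (deriv c u) (deriv (deriv c) u)) (L : ℝ) :
    fullAffineLength c L = ∫ u in (0 : ℝ)..L,
      √(densitySq (deriv c u) (deriv^[2] c u) (deriv^[3] c u) (deriv^[4] c u)) := by
  unfold fullAffineLength
  refine intervalIntegral.integral_congr fun u _ => ?_
  have h : affineCurvature c u * affineSpeed c u ^ 2 = densitySq (deriv c u) (deriv^[2] c u) _ _ :=
    affineCurvature_mul_affineSpeed_sq hc hD u
  change √(affineCurvature c u) * affineSpeed c u = _
  rw [← h, Real.sqrt_mul' _ (sq_nonneg _), Real.sqrt_sq (affineSpeed_pos hD u).le]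

theorem totalAffineCurvature_eq (hc : ContDiff ℝ ∞ c)
    (hD : ∀ u, 0 < areaForm (deriv c u) (deriv (deriv c) u)) (L : ℝ) :
    totalAffineCurvature c L = ∫ u in (0 : ℝ)..L,
      densitySq (deriv c u) (deriv^[2] c u) (deriv^[3] c u) (deriv^[4] c u) /
        (areaForm (deriv c u) (deriv^[2] c u)) ^ (1 / 3 : ℝ) := by
  unfold totalAffineCurvature
  refine intervalIntegral.integral_congr fun u _ => ?_
  have h : affineCurvature c u * affineSpeed c u ^ 2 = densitySq (deriv c u) (deriv^[2] c u) _ _ :=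
    affineCurvature_mul_affineSpeed_sq hc hD u
  change affineCurvature c u * affineSpeed c u = _
  rw [← h, show areaForm (deriv c u) (deriv^[2] c u) ^ (1 / 3 : ℝ) = affineSpeed c u from rfl]
  have := (affineSpeed_pos hD u).ne'
  field_simp

end curvature

/-! ### Behaviour of the functionals under homotheties. -/

section scaling

variable {c : ℝ → Plane} {k : ℝ}

theorem iterate_deriv_const_smul (hc : ContDiff ℝ ∞ c) (k : ℝ) (n : ℕ) :
    deriv^[n] (fun u => k • c u) = fun u => k • deriv^[n] c u := by
  induction n with
  | zero => rfl
  | succ n ih =>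
    rw [Function.iterate_succ_apply', ih]
    exact funext fun u => ((hc.hasDerivAt_iterate_deriv n u).const_smul k).deriv

theorem areaForm_deriv_const_smul_pos (hc : ContDiff ℝ ∞ c) (hk : 0 < k) {u : ℝ}
    (hD : 0 < areaForm (deriv c u) (deriv (deriv c) u)) :
    0 < areaForm (deriv (fun u => k • c u) u) (deriv (deriv fun u => k • c u) u) := by
  have h1 := iterate_deriv_const_smul hc k 1
  have h2 := iterate_deriv_const_smul hc k 2
  simp only [Function.iterate_succ, Function.iterate_zero, Function.comp_apply, id] at h1 h2
  rw [h2, h1, areaForm_smul_smul]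
  positivity

theorem affineCurvature_const_smul_pos (hc : ContDiff ℝ ∞ c) (hk : 0 < k)
    (hD : ∀ u, 0 < areaForm (deriv c u) (deriv (deriv c) u)) {u : ℝ}
    (hu : 0 < affineCurvature c u) : 0 < affineCurvature (fun u => k • c u) u := by
  have h1 := iterate_deriv_const_smul hc k 1
  rw [Function.iterate_one] at h1
  rw [affineCurvature_pos_iff (hc.const_smul k) fun u => areaForm_deriv_const_smul_pos hc hk (hD u)]
  rw [affineCurvature_pos_iff hc hD] at hu
  rw [iterate_deriv_const_smul hc k 2, iterate_deriv_const_smul hc k 3,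
    iterate_deriv_const_smul hc k 4, h1, densitySq_smul hk.ne']
  exact hu

theorem fullAffineLength_const_smul (hc : ContDiff ℝ ∞ c) (hk : 0 < k)
    (hD : ∀ u, 0 < areaForm (deriv c u) (deriv (deriv c) u)) (L : ℝ) :
    fullAffineLength (fun u => k • c u) L = fullAffineLength c L := by
  have h1 := iterate_deriv_const_smul hc k 1
  rw [Function.iterate_one] at h1
  rw [fullAffineLength_eq (hc.const_smul k) fun u => areaForm_deriv_const_smul_pos hc hk (hD u),
    fullAffineLength_eq hc hD, iterate_deriv_const_smul hc k 2, iterate_deriv_const_smul hc k 3,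
    iterate_deriv_const_smul hc k 4, h1]
  simp only [densitySq_smul hk.ne']

theorem enclosedArea_const_smul (hc : ContDiff ℝ ∞ c) (k L : ℝ) :
    enclosedArea (fun u => k • c u) L = k ^ 2 * enclosedArea c L := by
  have h1 := iterate_deriv_const_smul hc k 1
  rw [Function.iterate_one] at h1
  unfold enclosedArea
  simp only [h1, areaForm_smul_smul, intervalIntegral.integral_const_mul]
  ring

theorem affineSpeed_const_smul (hc : ContDiff ℝ ∞ c) (hk : 0 < k)
    (hD : ∀ u, 0 < areaForm (deriv c u) (deriv (deriv c) u)) (u : ℝ) :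
    affineSpeed (fun u => k • c u) u = k ^ (2 / 3 : ℝ) * affineSpeed c u := by
  have h1 := iterate_deriv_const_smul hc k 1
  have h2 := iterate_deriv_const_smul hc k 2
  simp only [Function.iterate_succ, Function.iterate_zero, Function.comp_apply, id] at h1 h2
  unfold affineSpeed
  rw [h2, h1, areaForm_smul_smul, Real.mul_rpow (by positivity) (hD u).le, ← sq,
    ← Real.rpow_natCast, ← Real.rpow_mul hk.le]
  norm_num

theorem affineLength_const_smul (hc : ContDiff ℝ ∞ c) (hk : 0 < k)
    (hD : ∀ u, 0 < areaForm (deriv c u) (deriv (deriv c) u)) (L : ℝ) :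
    affineLength (fun u => k • c u) L = k ^ (2 / 3 : ℝ) * affineLength c L := by
  unfold affineLength
  simp only [affineSpeed_const_smul hc hk hD, intervalIntegral.integral_const_mul]

/-- Under a homothety of ratio `k` the curvature scales by `k^(-4/3)` and `ds` by `k^(2/3)`. -/
theorem totalAffineCurvature_const_smul (hc : ContDiff ℝ ∞ c) (hk : 0 < k)
    (hD : ∀ u, 0 < areaForm (deriv c u) (deriv (deriv c) u)) (L : ℝ) :
    totalAffineCurvature (fun u => k • c u) L
      = k ^ (-(2 / 3) : ℝ) * totalAffineCurvature c L := by
  have h1 := iterate_deriv_const_smul hc k 1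
  rw [Function.iterate_one] at h1
  rw [totalAffineCurvature_eq (hc.const_smul k)
    fun u => areaForm_deriv_const_smul_pos hc hk (hD u),
    totalAffineCurvature_eq hc hD, iterate_deriv_const_smul hc k 2,
    iterate_deriv_const_smul hc k 3, iterate_deriv_const_smul hc k 4, h1,
    ← intervalIntegral.integral_const_mul]
  refine intervalIntegral.integral_congr fun u _ => ?_
  simp only [densitySq_smul hk.ne', areaForm_smul_smul]
  have hDu : 0 ≤ areaForm (deriv c u) (deriv^[2] c u) := (hD u).le
  rw [Real.mul_rpow (by positivity) hDu, ← sq, ← Real.rpow_natCast, ← Real.rpow_mul hk.le,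
    Real.rpow_neg hk.le]
  norm_num
  field_simp

end scaling

/-! ### Curves parametrised by equi-affine arc-length -/

section arcLength

variable {γ : ℝ → Plane}

theorem areaForm_frame_expansion (v w x : Plane) (h : areaForm v w = 1) :
    x = areaForm x w • v + areaForm v x • w := by
  simp only [areaForm] at h ⊢
  ext
  · simp only [Prod.fst_add, Prod.smul_fst, smul_eq_mul]
    linear_combination (-x.1) * h
  · simp only [Prod.snd_add, Prod.smul_snd, smul_eq_mul]
    linear_combination (-x.2) * h

theorem affineCurvature_of_arcLength
    (h1 : ∀ s, areaForm (deriv γ s) (deriv (deriv γ) s) = 1) (s : ℝ) :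
    affineCurvature γ s = areaForm (deriv^[2] γ s) (deriv^[3] γ s) := by
  have hs : ∀ s, affineSpeed γ s = 1 := fun s => by rw [affineSpeed, h1, Real.one_rpow]
  have ha : ∀ h : ℝ → Plane, arcDeriv γ h = deriv h := fun h => by
    funext s; simp [arcDeriv, hs]
  simp only [affineCurvature, affineNormal, affineTangent, ha]
  rfl

theorem areaForm_deriv_deriv_three (hγ : ContDiff ℝ ∞ γ)
    (h1 : ∀ s, areaForm (deriv γ s) (deriv (deriv γ) s) = 1) (s : ℝ) :
    areaForm (deriv γ s) (deriv^[3] γ s) = 0 := by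
  have h := (hγ.hasDerivAt_iterate_deriv 1 s).areaForm (hγ.hasDerivAt_iterate_deriv 2 s)
  have h2 : (fun v => areaForm (deriv^[1] γ v) (deriv^[2] γ v)) = fun _ => 1 := funext h1
  rw [h2, areaForm_self, zero_add] at h
  exact h.unique (hasDerivAt_const s 1)

theorem deriv_three_of_arcLength (hγ : ContDiff ℝ ∞ γ)
    (h1 : ∀ s, areaForm (deriv γ s) (deriv (deriv γ) s) = 1) (s : ℝ) :
    deriv^[3] γ s = -(affineCurvature γ s • deriv γ s) := by
  rw [areaForm_frame_expansion _ _ (deriv^[3] γ s) (h1 s), areaForm_deriv_deriv_three hγ h1,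
    areaForm_swap, affineCurvature_of_arcLength h1, zero_smul, add_zero, neg_smul]
  rfl

theorem areaForm_deriv_deriv_four (hγ : ContDiff ℝ ∞ γ)
    (h1 : ∀ s, areaForm (deriv γ s) (deriv (deriv γ) s) = 1) (s : ℝ) :
    areaForm (deriv γ s) (deriv^[4] γ s) = -affineCurvature γ s := by
  have h := (hγ.hasDerivAt_iterate_deriv 1 s).areaForm (hγ.hasDerivAt_iterate_deriv 3 s)
  have h2 : (fun v => areaForm (deriv^[1] γ v) (deriv^[3] γ v)) = fun _ => 0 :=
    funext (areaForm_deriv_deriv_three hγ h1)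
  rw [h2] at h
  rw [affineCurvature_of_arcLength h1]
  exact eq_neg_of_add_eq_zero_right (h.unique (hasDerivAt_const s 0))

theorem contDiff_affineCurvature_of_arcLength (hγ : ContDiff ℝ ∞ γ)
    (h1 : ∀ s, areaForm (deriv γ s) (deriv (deriv γ) s) = 1) :
    ContDiff ℝ ∞ (affineCurvature γ) := by
  rw [funext (affineCurvature_of_arcLength h1)]
  exact (hγ.iterate_deriv 2).areaForm (hγ.iterate_deriv 3)

theorem periodic_deriv {E : Type*} [NormedAddCommGroup E] [NormedSpace ℝ E] {c : ℝ → E} {L : ℝ}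
    (h : Function.Periodic c L) : Function.Periodic (deriv c) L := fun u => by
  rw [← deriv_comp_add_const]
  exact congrArg (deriv · u) (funext h)

theorem periodic_iterate_deriv {E : Type*} [NormedAddCommGroup E] [NormedSpace ℝ E] {c : ℝ → E}
    {L : ℝ} (h : Function.Periodic c L) (n : ℕ) : Function.Periodic (deriv^[n] c) L := by
  induction n with
  | zero => exact h
  | succ n ih => rw [Function.iterate_succ_apply']; exact periodic_deriv ih

theorem periodic_affineCurvature_of_arcLength
    (h1 : ∀ s, areaForm (deriv γ s) (deriv (deriv γ) s) = 1) {L : ℝ}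
    (h : Function.Periodic γ L) : Function.Periodic (affineCurvature γ) L := fun u => by
  rw [affineCurvature_of_arcLength h1, affineCurvature_of_arcLength h1,
    periodic_iterate_deriv h, periodic_iterate_deriv h]

end arcLength

/-! ### Smoothness of the functionals along a deformation, and the first variation -/

/-- The hypotheses at `t` are the relations satisfied by the derivatives of a curve in equi-affine
arc-length, for which `densitySq` equals `κ`. The term in `|c₁, c₃|²` vanishes to second order there
and drops out. The term with factor `κ` comes from the denominator `3 |c₁, c₂|`. -/
theorem hasDerivAt_sqrt_densitySq {c₁ c₂ c₃ c₄ : ℝ → Plane} {v₁ v₂ v₃ v₄ : Plane} {t κ : ℝ}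
    (h₁ : HasDerivAt c₁ v₁ t) (h₂ : HasDerivAt c₂ v₂ t) (h₃ : HasDerivAt c₃ v₃ t)
    (h₄ : HasDerivAt c₄ v₄ t) (hκ : 0 < κ) (h12 : areaForm (c₁ t) (c₂ t) = 1)
    (h13 : areaForm (c₁ t) (c₃ t) = 0) (h23 : areaForm (c₂ t) (c₃ t) = κ)
    (h14 : areaForm (c₁ t) (c₄ t) = -κ) :
    HasDerivAt (fun s => √(densitySq (c₁ s) (c₂ s) (c₃ s) (c₄ s)))
      (((4 * (areaForm v₂ (c₃ t) + areaForm (c₂ t) v₃)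
          + (areaForm v₁ (c₄ t) + areaForm (c₁ t) v₄)) / 3
        - κ * (areaForm v₁ (c₂ t) + areaForm (c₁ t) v₂)) / (2 * √κ)) t := by
  have hq : densitySq (c₁ t) (c₂ t) (c₃ t) (c₄ t) = κ := by
    rw [densitySq, h12, h13, h23, h14]; ring
  have hd := ((((h₂.areaForm h₃).const_mul 4).add (h₁.areaForm h₄)).div
    ((h₁.areaForm h₂).const_mul 3) (by rw [h12]; norm_num)).sub
    ((((h₁.areaForm h₃).pow 2).const_mul 5).div (((h₁.areaForm h₂).pow 2).const_mul 9)
      (by simp only [Pi.pow_apply]; rw [h12]; norm_num))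
  have hd2 : HasDerivAt (fun s => densitySq (c₁ s) (c₂ s) (c₃ s) (c₄ s)) _ t := hd
  refine (hd2.sqrt (by rw [hq]; exact hκ.ne')).congr_deriv ?_
  rw [hq]
  congr 1
  simp only [Pi.pow_apply, Pi.add_apply, h12, h13, h23, h14]
  ring

section deformation

variable {γ : ℝ → Plane} {L ε : ℝ} {Γ : ℝ → ℝ → Plane}

namespace IsDeformation

theorem contDiff (hΓ : IsDeformation γ L ε Γ) {t : ℝ} (ht : t ∈ Ioo (-ε) ε) :
    ContDiff ℝ ∞ (Γ t) := contDiff_section ht hΓ.smooth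

theorem iterate_deriv_eq (hΓ : IsDeformation γ L ε Γ) {t : ℝ} (ht : t ∈ Ioo (-ε) ε) (k : ℕ)
    (u : ℝ) : deriv^[k] (Γ t) u = (partialSnd^[k] fun p : ℝ × ℝ => Γ p.1 p.2) (t, u) :=
  congrFun (iterate_deriv_eq_iterate_partialSnd isOpen_Ioo hΓ.smooth ht k) u

theorem contDiffOn_iterate_deriv (hΓ : IsDeformation γ L ε Γ) (k : ℕ) :
    ContDiffOn ℝ ∞ (fun p : ℝ × ℝ => deriv^[k] (Γ p.1) p.2) (Ioo (-ε) ε ×ˢ univ) :=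
  (contDiffOn_iterate_partialSnd (isOpen_Ioo.prod isOpen_univ) hΓ.smooth k).congr
    fun p hp => hΓ.iterate_deriv_eq hp.1 k p.2

theorem contDiffOn_areaForm (hΓ : IsDeformation γ L ε Γ) (j k : ℕ) :
    ContDiffOn ℝ ∞ (fun p : ℝ × ℝ => areaForm (deriv^[j] (Γ p.1) p.2) (deriv^[k] (Γ p.1) p.2))
      (Ioo (-ε) ε ×ˢ univ) :=
  (hΓ.contDiffOn_iterate_deriv j).areaForm (hΓ.contDiffOn_iterate_deriv k)

theorem contDiffOn_densitySq (hΓ : IsDeformation γ L ε Γ) :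
    ContDiffOn ℝ ∞ (fun p : ℝ × ℝ => densitySq (deriv (Γ p.1) p.2) (deriv^[2] (Γ p.1) p.2)
      (deriv^[3] (Γ p.1) p.2) (deriv^[4] (Γ p.1) p.2)) (Ioo (-ε) ε ×ˢ univ) := by
  have hne : ∀ p ∈ Ioo (-ε) ε ×ˢ (univ : Set ℝ),
      areaForm (deriv^[1] (Γ p.1) p.2) (deriv^[2] (Γ p.1) p.2) ≠ 0 :=
    fun p hp => (hΓ.nondegenerate p.1 hp.1 p.2).ne'
  refine ContDiffOn.sub (ContDiffOn.div ((contDiffOn_const.mul (hΓ.contDiffOn_areaForm 2 3)).add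
    (hΓ.contDiffOn_areaForm 1 4)) (contDiffOn_const.mul (hΓ.contDiffOn_areaForm 1 2)) fun p hp => ?_)
    (ContDiffOn.div (contDiffOn_const.mul ((hΓ.contDiffOn_areaForm 1 3).pow 2))
      (contDiffOn_const.mul ((hΓ.contDiffOn_areaForm 1 2).pow 2)) fun p hp => ?_)
  · exact mul_ne_zero (by norm_num) (hne p hp)
  · exact mul_ne_zero (by norm_num) (pow_ne_zero 2 (hne p hp))

theorem densitySq_pos (hΓ : IsDeformation γ L ε Γ) {t : ℝ} (ht : t ∈ Ioo (-ε) ε) (u : ℝ) :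
    0 < densitySq (deriv (Γ t) u) (deriv^[2] (Γ t) u) (deriv^[3] (Γ t) u) (deriv^[4] (Γ t) u) :=
  (affineCurvature_pos_iff (hΓ.contDiff ht) (hΓ.nondegenerate t ht) u).1 (hΓ.curvature_pos t ht u)

theorem contDiffOn_enclosedArea (hΓ : IsDeformation γ L ε Γ) :
    ContDiffOn ℝ ∞ (fun t => enclosedArea (Γ t) L) (Ioo (-ε) ε) :=
  contDiffOn_const.mul (contDiffOn_integral isOpen_Ioo L (hΓ.contDiffOn_areaForm 0 1))

theorem contDiffOn_affineSpeed (hΓ : IsDeformation γ L ε Γ) :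
    ContDiffOn ℝ ∞ (fun p : ℝ × ℝ => affineSpeed (Γ p.1) p.2) (Ioo (-ε) ε ×ˢ univ) :=
  (hΓ.contDiffOn_areaForm 1 2).rpow_const_of_ne fun p hp => (hΓ.nondegenerate p.1 hp.1 p.2).ne'

theorem contDiffOn_affineLength (hΓ : IsDeformation γ L ε Γ) :
    ContDiffOn ℝ ∞ (fun t => affineLength (Γ t) L) (Ioo (-ε) ε) :=
  contDiffOn_integral isOpen_Ioo L hΓ.contDiffOn_affineSpeed

theorem contDiffOn_totalAffineCurvature (hΓ : IsDeformation γ L ε Γ) :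
    ContDiffOn ℝ ∞ (fun t => totalAffineCurvature (Γ t) L) (Ioo (-ε) ε) :=
  (contDiffOn_integral isOpen_Ioo L (hΓ.contDiffOn_densitySq.div hΓ.contDiffOn_affineSpeed
    fun p hp => (affineSpeed_pos (hΓ.nondegenerate p.1 hp.1) p.2).ne')).congr fun t ht =>
      totalAffineCurvature_eq (hΓ.contDiff ht) (hΓ.nondegenerate t ht) L

theorem exists_hasDerivAt_fullAffineLength (hγ : IsSimpleClosedPositivelyCurved γ L) (hε : 0 < ε)
    (hΓ : IsDeformation γ L ε Γ) :
    ∃ V : ℝ → Plane, ContDiff ℝ ∞ V ∧ Function.Periodic V L ∧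
      (∀ u, HasDerivAt (fun t => Γ t u) (V u) 0) ∧
      HasDerivAt (fun t => fullAffineLength (Γ t) L)
        (∫ u in (0 : ℝ)..L,
          ((4 * (areaForm (deriv^[2] V u) (deriv^[3] γ u) + areaForm (deriv^[2] γ u) (deriv^[3] V u))
            + (areaForm (deriv V u) (deriv^[4] γ u) + areaForm (deriv γ u) (deriv^[4] V u))) / 3
          - affineCurvature γ u *
            (areaForm (deriv V u) (deriv^[2] γ u) + areaForm (deriv γ u) (deriv^[2] V u)))
            / (2 * √(affineCurvature γ u))) 0 := by
  have h0 : (0 : ℝ) ∈ Ioo (-ε) ε := by simpa using hε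
  have hI : IsOpen (Ioo (-ε) ε) := isOpen_Ioo
  have hU : IsOpen (Ioo (-ε) ε ×ˢ (univ : Set ℝ)) := hI.prod isOpen_univ
  set f : ℝ × ℝ → Plane := fun p => Γ p.1 p.2 with hf
  have hVd : ∀ u, HasDerivAt (fun t => Γ t u) (partialFst f (0, u)) 0 := fun u =>
    hasDerivAt_partialFst hU hΓ.smooth ⟨h0, trivial⟩
  have hF1 := contDiffOn_partialFst hU hΓ.smooth
  refine ⟨fun u => partialFst f (0, u), contDiff_section h0 hF1, fun u => ?_, hVd, ?_⟩
  -- The variation field inherits the period because every nearby curve has the same one.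
  · refine ((hVd (u + L)).congr_of_eventuallyEq ?_).unique (hVd u)
    filter_upwards [hI.mem_nhds h0] with t ht
    exact (hΓ.closed t ht u).symm
  have hS : ContDiffOn ℝ ∞ (fun p : ℝ × ℝ => √(densitySq (deriv (Γ p.1) p.2)
      (deriv^[2] (Γ p.1) p.2) (deriv^[3] (Γ p.1) p.2) (deriv^[4] (Γ p.1) p.2)))
      (Ioo (-ε) ε ×ˢ univ) :=
    hΓ.contDiffOn_densitySq.sqrt fun p hp => (hΓ.densitySq_pos hp.1 p.2).ne'
  have hmain := hasDerivAt_integral_partialFst hI hS L h0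
  refine (hmain.congr_of_eventuallyEq ?_).congr_deriv ?_
  · filter_upwards [hI.mem_nhds h0] with t ht
    exact fullAffineLength_eq (hΓ.contDiff ht) (hΓ.nondegenerate t ht) L
  refine intervalIntegral.integral_congr fun u _ => ?_
  -- Mixed partial derivatives commute, so the derivatives of the curve vary by the derivatives of
  -- the variation field.
  have hk : ∀ k, HasDerivAt (fun t => deriv^[k] (Γ t) u)
      (deriv^[k] (fun u => partialFst f (0, u)) u) 0 := fun k => by
    have h := hasDerivAt_partialFst hU (contDiffOn_iterate_partialSnd hU hΓ.smooth k)
      (show ((0 : ℝ), u) ∈ _ from ⟨h0, trivial⟩)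
    rw [partialFst_iterate_partialSnd hU hΓ.smooth k ⟨h0, trivial⟩] at h
    rw [iterate_deriv_eq_iterate_partialSnd hI hF1 h0 k]
    refine h.congr_of_eventuallyEq ?_
    filter_upwards [hI.mem_nhds h0] with t ht
    exact hΓ.iterate_deriv_eq ht k u
  have hst := hΓ.start
  have hA : areaForm (deriv^[2] (Γ 0) u) (deriv^[3] (Γ 0) u) = affineCurvature γ u := by
    rw [hst]; exact (affineCurvature_of_arcLength hγ.arcLength u).symm
  have key := hasDerivAt_sqrt_densitySq (hk 1) (hk 2) (hk 3) (hk 4) (hγ.curvature_pos u)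
    (by rw [hst]; exact hγ.arcLength u)
    (by rw [hst]; exact areaForm_deriv_deriv_three hγ.smooth hγ.arcLength u) hA
    (by rw [hst]; exact areaForm_deriv_deriv_four hγ.smooth hγ.arcLength u)
  rw [hst] at key
  exact (hasDerivAt_partialFst hU hS ⟨h0, trivial⟩).unique key

end IsDeformation

end deformation

/-! ### Curves of constant equi-affine curvature are critical -/

theorem integral_eq_zero_of_hasDerivAt_periodic {W f : ℝ → ℝ} {L : ℝ} (hf : Continuous f)
    (hW : ∀ u, HasDerivAt W (f u) u) (hp : Function.Periodic W L) :
    ∫ u in (0 : ℝ)..L, f u = 0 := by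
  rw [intervalIntegral.integral_eq_sub_of_hasDerivAt (fun u _ => hW u)
    (hf.intervalIntegrable _ _), hp.eq, sub_self]

/-- For constant `κ` the weight `1 / (2√κ)` is constant, and `γ''' = -k γ'` makes the rest of the
integrand exact. -/
theorem isCriticalPoint_of_affineCurvature_const {γ : ℝ → Plane} {L k : ℝ}
    (hγ : IsSimpleClosedPositivelyCurved γ L) (hk : ∀ s, affineCurvature γ s = k) :
    IsCriticalPoint fullAffineLength γ L := by
  intro ε Γ hε hΓ
  obtain ⟨V, hV, hVp, -, hF⟩ := hΓ.exists_hasDerivAt_fullAffineLength hγ hε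
  refine hF.congr_deriv ?_
  have hc := hγ.smooth
  have g := hc.hasDerivAt_iterate_deriv
  have v := hV.hasDerivAt_iterate_deriv
  have gp := periodic_iterate_deriv hγ.closed
  have vp := periodic_iterate_deriv hVp
  have h3 : ∀ u, deriv^[3] γ u = -(k • deriv γ u) := fun u => by
    rw [deriv_three_of_arcLength hc hγ.arcLength, hk]
  -- The summand divided by `3` accounts for the fourth derivatives. What remains is `|γ'', V'''| +
  -- k |γ'', V'|`, the derivative of the first two summands.
  refine integral_eq_zero_of_hasDerivAt_periodic (W := fun u =>
    ((areaForm (deriv^[2] γ u) (deriv^[2] V u) + k * areaForm (deriv^[1] γ u) (deriv^[1] V u))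
      + (areaForm (deriv^[1] V u) (deriv^[3] γ u) + areaForm (deriv^[1] γ u) (deriv^[3] V u)) / 3)
      / (2 * √k)) ?_ (fun u => ?_) (fun u => ?_)
  · have e : ∀ m n, Continuous fun u => areaForm (deriv^[m] V u) (deriv^[n] γ u) := fun m n =>
      ((hV.iterate_deriv m).areaForm (hc.iterate_deriv n)).continuous
    have e' : ∀ m n, Continuous fun u => areaForm (deriv^[m] γ u) (deriv^[n] V u) := fun m n =>
      ((hc.iterate_deriv m).areaForm (hV.iterate_deriv n)).continuous
    simp only [hk]
    exact ((((((e 2 3).add (e' 2 3)).const_mul 4).add ((e 1 4).add (e' 1 4))).div_const 3).sub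
      (((e 1 2).add (e' 1 2)).const_mul k)).div_const _
  · have h := (((((g 2 u).areaForm (v 2 u)).add (((g 1 u).areaForm (v 1 u)).const_mul k)).add
      ((((v 1 u).areaForm (g 3 u)).add ((g 1 u).areaForm (v 3 u))).div_const 3)).div_const
        (2 * √k))
    refine h.congr_deriv ?_
    simp only [hk, Nat.reduceAdd, h3, Function.iterate_one]
    congr 1
    simp only [areaForm, Prod.fst_neg, Prod.snd_neg, Prod.smul_fst, Prod.smul_snd, smul_eq_mul]
    ring
  · simp only [gp _ u, vp _ u]

/-! ### A deformation that detects non-constant curvature -/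

/-- Compactness of one period makes the positivity uniform in `u`. -/
theorem exists_pos_forall_of_periodic {H : ℝ × ℝ → ℝ} {L : ℝ} (hL : 0 < L) (hc : Continuous H)
    (hp : ∀ t u, H (t, u + L) = H (t, u)) (h0 : ∀ u, 0 < H (0, u)) :
    ∃ ε > 0, ∀ t ∈ Ioo (-ε) ε, ∀ u, 0 < H (t, u) := by
  have hev : ∀ᶠ t in nhds (0 : ℝ), ∀ u ∈ Icc (0 : ℝ) L, 0 < H (t, u) := by
    refine isCompact_Icc.eventually_forall_of_forall_eventually fun u _ => ?_
    exact hc.continuousAt.eventually (lt_mem_nhds (h0 u))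
  obtain ⟨ε, hε, h⟩ := Metric.eventually_nhds_iff.1 hev
  refine ⟨ε, hε, fun t ht u => ?_⟩
  have hper : Function.Periodic (fun u => H (t, u)) L := hp t
  obtain ⟨y, hy, he⟩ := hper.exists_mem_Ico₀ hL u
  rw [show H (t, u) = H (t, y) from he]
  exact h (by rw [Real.dist_eq, sub_zero]; exact abs_lt.2 ht) y (Ico_subset_Icc_self hy)

theorem iterate_deriv_add_const_smul {γ V : ℝ → Plane} (hγ : ContDiff ℝ ∞ γ) (hV : ContDiff ℝ ∞ V)
    (t : ℝ) (n : ℕ) :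
    deriv^[n] (fun u => γ u + t • V u) = fun u => deriv^[n] γ u + t • deriv^[n] V u := by
  induction n with
  | zero => rfl
  | succ n ih =>
    rw [Function.iterate_succ_apply', ih]
    exact funext fun u =>
      ((hγ.hasDerivAt_iterate_deriv n u).add ((hV.hasDerivAt_iterate_deriv n u).const_smul t)).deriv

theorem exists_isDeformation_linear {γ V : ℝ → Plane} {L : ℝ}
    (hγ : IsSimpleClosedPositivelyCurved γ L) (hV : ContDiff ℝ ∞ V)
    (hVp : Function.Periodic V L) :
    ∃ ε > 0, IsDeformation γ L ε fun t u => γ u + t • V u := by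
  have hc := hγ.smooth
  have hd := iterate_deriv_add_const_smul hc hV
  have hs : ∀ n, Continuous fun p : ℝ × ℝ => deriv^[n] (fun u => γ u + p.1 • V u) p.2 := by
    intro n
    simp only [hd]
    have h1 := (hc.iterate_deriv n).continuous
    have h2 := (hV.iterate_deriv n).continuous
    fun_prop
  have hsmooth : ∀ t : ℝ, ContDiff ℝ ∞ fun u => γ u + t • V u := fun t =>
    hc.add (hV.const_smul t)
  have hper : ∀ t : ℝ, Function.Periodic (fun u => γ u + t • V u) L := fun t u => by
    simp only [hγ.closed u, hVp u]
  have hA : ∀ m n, Continuous fun p : ℝ × ℝ => areaForm (deriv^[m] (fun u => γ u + p.1 • V u) p.2)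
      (deriv^[n] (fun u => γ u + p.1 • V u) p.2) := fun m n =>
    ((hs m).fst.mul (hs n).snd).sub ((hs m).snd.mul (hs n).fst)
  have hAp : ∀ m n t u, areaForm (deriv^[m] (fun u => γ u + t • V u) (u + L))
      (deriv^[n] (fun u => γ u + t • V u) (u + L)) = areaForm (deriv^[m] (fun u => γ u + t • V u) u)
      (deriv^[n] (fun u => γ u + t • V u) u) := fun m n t u => by
    rw [periodic_iterate_deriv (hper t), periodic_iterate_deriv (hper t)]
  have hz : (fun u => γ u + (0 : ℝ) • V u) = γ := by simp
  obtain ⟨ε₁, h₁, H₁⟩ := exists_pos_forall_of_periodic hγ.period_pos (hA 1 2) (hAp 1 2)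
    (fun u => by
      simp only [hz]
      exact (hγ.arcLength u).symm ▸ one_pos)
  -- This `H` is `densitySq` multiplied by `9 |c', c''|²`. Without denominators it is continuous for
  -- all `t`, even where `|c', c''|` vanishes. At `t = 0` it equals `9κ`.
  obtain ⟨ε₂, h₂, H₂⟩ := exists_pos_forall_of_periodic (H := fun p : ℝ × ℝ =>
      3 * (4 * areaForm (deriv^[2] (fun u => γ u + p.1 • V u) p.2)
        (deriv^[3] (fun u => γ u + p.1 • V u) p.2)
      + areaForm (deriv^[1] (fun u => γ u + p.1 • V u) p.2)
        (deriv^[4] (fun u => γ u + p.1 • V u) p.2)) *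
      areaForm (deriv^[1] (fun u => γ u + p.1 • V u) p.2)
        (deriv^[2] (fun u => γ u + p.1 • V u) p.2) -
      5 * areaForm (deriv^[1] (fun u => γ u + p.1 • V u) p.2)
        (deriv^[3] (fun u => γ u + p.1 • V u) p.2) ^ 2) hγ.period_pos
    (by have := hA 2 3; have := hA 1 4; have := hA 1 2; have := hA 1 3; fun_prop)
    (fun t u => by simp only [hAp])
    (fun u => by
      simp only [hz]
      have h12 : areaForm (deriv^[1] γ u) (deriv^[2] γ u) = 1 := hγ.arcLength u
      have h13 : areaForm (deriv^[1] γ u) (deriv^[3] γ u) = 0 :=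
        areaForm_deriv_deriv_three hc hγ.arcLength u
      have h14 : areaForm (deriv^[1] γ u) (deriv^[4] γ u) = _ :=
        areaForm_deriv_deriv_four hc hγ.arcLength u
      rw [h12, h13, h14, ← affineCurvature_of_arcLength hγ.arcLength]
      linarith [hγ.curvature_pos u])
  refine ⟨min ε₁ ε₂, lt_min h₁ h₂, ?_⟩
  have hI1 : Ioo (-(min ε₁ ε₂)) (min ε₁ ε₂) ⊆ Ioo (-ε₁) ε₁ :=
    Ioo_subset_Ioo (neg_le_neg (min_le_left _ _)) (min_le_left _ _)
  have hI2 : Ioo (-(min ε₁ ε₂)) (min ε₁ ε₂) ⊆ Ioo (-ε₂) ε₂ :=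
    Ioo_subset_Ioo (neg_le_neg (min_le_right _ _)) (min_le_right _ _)
  refine ⟨ContDiff.contDiffOn ?_, hz, fun t _ => hper t, fun t ht u => H₁ t (hI1 ht) u,
    fun t ht u => ?_⟩
  · exact (hc.comp contDiff_snd).add (contDiff_fst.smul (hV.comp contDiff_snd))
  · rw [affineCurvature_pos_iff (hsmooth t) (fun u => H₁ t (hI1 ht) u)]
    have hD := H₁ t (hI1 ht) u
    have hR := H₂ t (hI2 ht) u
    simp only [Function.iterate_one] at hD hR
    rw [densitySq, sub_pos, div_lt_div_iff₀ (by positivity) (by positivity)]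
    nlinarith [mul_pos hD hR]

theorem eq_const_of_iterate_deriv_two_eq_zero {g : ℝ → ℝ} {L : ℝ} (hL : 0 < L)
    (hg : ContDiff ℝ ∞ g) (hp : Function.Periodic g L) (h : ∀ u, deriv^[2] g u = 0) (u : ℝ) :
    g u = g 0 := by
  have h1 : ∀ x, deriv g x = deriv g 0 := fun x =>
    is_const_of_deriv_eq_zero ((hg.iterate_deriv 1).differentiable (by simp)) h x 0
  have h2 : ∫ x in (0 : ℝ)..L, deriv g x = 0 :=
    integral_eq_zero_of_hasDerivAt_periodic (W := g) (hg.iterate_deriv 1).continuous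
      (hg.hasDerivAt_iterate_deriv 0) hp
  have h3 : deriv g 0 = 0 := by
    simp only [h1, intervalIntegral.integral_const, smul_eq_mul, sub_zero] at h2
    exact (mul_eq_zero.1 h2).resolve_left hL.ne'
  exact is_const_of_deriv_eq_zero (hg.differentiable (by simp)) (fun x => (h1 x).trans h3) u 0

/-- Affine deformations `γ + t V` with the single field `V = γ'' / κ` already suffice: along it the
first variation is the integral of a nonnegative function vanishing only where `(κ^(-1/2))'' = 0`.
-/
theorem affineCurvature_const_of_hasDerivAt_zero {γ : ℝ → Plane} {L : ℝ}
    (hγ : IsSimpleClosedPositivelyCurved γ L)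
    (H : ∀ (V : ℝ → Plane) (ε : ℝ), ContDiff ℝ ∞ V → Function.Periodic V L → 0 < ε →
      IsDeformation γ L ε (fun (t : ℝ) u => γ u + t • V u) →
      HasDerivAt (fun t : ℝ => fullAffineLength (fun u => γ u + t • V u) L) 0 0) (s : ℝ) :
    affineCurvature γ s = affineCurvature γ 0 := by
  have hc := hγ.smooth
  have hpos := hγ.curvature_pos
  set κ := affineCurvature γ with hκdef
  have hκ : ContDiff ℝ ∞ κ := contDiff_affineCurvature_of_arcLength hc hγ.arcLength
  have hκp : Function.Periodic κ L := periodic_affineCurvature_of_arcLength hγ.arcLength hγ.closed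
  set g : ℝ → ℝ := fun u => (√(κ u))⁻¹ with hgdef
  have hsq : ∀ u, 0 < √(κ u) := fun u => Real.sqrt_pos.2 (hpos u)
  have hg : ContDiff ℝ ∞ g := (hκ.sqrt fun u => (hpos u).ne').inv fun u => (hsq u).ne'
  have hg0 : ∀ u, 0 < g u := fun u => inv_pos.2 (hsq u)
  have hgp : Function.Periodic g L := fun u => by simp only [hgdef, hκp u]
  have hgκ : ∀ u, g u ^ 2 * κ u = 1 := fun u => by
    simp only [hgdef, inv_pow, Real.sq_sqrt (hpos u).le]
    exact inv_mul_cancel₀ (hpos u).ne'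
  set g1 := deriv g
  set g2 := deriv^[2] g
  set g3 := deriv^[3] g
  set g4 := deriv^[4] g
  have d0 : ∀ u, HasDerivAt g (g1 u) u := hg.hasDerivAt_iterate_deriv 0
  have d1 : ∀ u, HasDerivAt g1 (g2 u) u := hg.hasDerivAt_iterate_deriv 1
  have d2 : ∀ u, HasDerivAt g2 (g3 u) u := hg.hasDerivAt_iterate_deriv 2
  have d3 : ∀ u, HasDerivAt g3 (g4 u) u := hg.hasDerivAt_iterate_deriv 3
  have k0 : ∀ u, HasDerivAt κ (deriv κ u) u := hκ.hasDerivAt_iterate_deriv 0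
  have k1 : ∀ u, HasDerivAt (deriv κ) (deriv^[2] κ u) u := hκ.hasDerivAt_iterate_deriv 1
  have hκ1 : ∀ u, g u * deriv κ u = -2 * g1 u * κ u := fun u => by
    have h := (((d0 u).pow 2).mul (k0 u)).unique ((hasDerivAt_const u (1 : ℝ)).congr_of_eventuallyEq
      (Filter.Eventually.of_forall hgκ))
    simp only [Pi.pow_apply, Nat.cast_ofNat, Nat.reduceSub, pow_one] at h
    have : g u * (g u * deriv κ u + 2 * g1 u * κ u) = 0 := by linear_combination h
    linarith [(mul_eq_zero.1 this).resolve_left (hg0 u).ne']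
  have t1 : ∀ u, HasDerivAt (deriv γ) (deriv^[2] γ u) u := hc.hasDerivAt_iterate_deriv 1
  have t2 : ∀ u, HasDerivAt (deriv^[2] γ) (-(κ u • deriv γ u)) u := fun u => by
    rw [← deriv_three_of_arcLength hc hγ.arcLength]; exact hc.hasDerivAt_iterate_deriv 2 u
  have h4 : ∀ u, deriv^[4] γ u = -(deriv κ u • deriv γ u) - κ u • deriv^[2] γ u := fun u => by
    have h := hc.hasDerivAt_iterate_deriv 3 u
    rw [funext (deriv_three_of_arcLength hc hγ.arcLength)] at h
    rw [h.unique ((k0 u).smul (t1 u)).neg]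
    abel
  set V : ℝ → Plane := fun u => (g u ^ 2) • deriv^[2] γ u with hVdef
  have hV : ContDiff ℝ ∞ V := (hg.pow 2).smul (hc.iterate_deriv 2)
  have hVp : Function.Periodic V L := fun u => by
    simp only [hVdef, hgp u, periodic_iterate_deriv hγ.closed 2 u]
  -- `b1`, ..., `b4` are the successive derivatives of the coefficient `g²` of `V`.
  set b1 : ℝ → ℝ := fun u => 2 * (g u * g1 u) with hb1
  set b2 : ℝ → ℝ := fun u => 2 * (g1 u * g1 u + g u * g2 u) with hb2
  set b3 : ℝ → ℝ := fun u => 2 * (3 * (g1 u * g2 u) + g u * g3 u) with hb3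
  set b4 : ℝ → ℝ := fun u => 2 * (3 * (g2 u * g2 u + g1 u * g3 u) + (g1 u * g3 u + g u * g4 u))
    with hb4
  have db0 : ∀ u, HasDerivAt (fun u => g u ^ 2) (b1 u) u := fun u =>
    ((d0 u).pow 2).congr_deriv (by simp only [hb1]; push_cast; ring)
  have db1 : ∀ u, HasDerivAt b1 (b2 u) u := fun u => ((d0 u).mul (d1 u)).const_mul 2
  have db2 : ∀ u, HasDerivAt b2 (b3 u) u := fun u =>
    ((((d1 u).mul (d1 u)).add ((d0 u).mul (d2 u))).const_mul 2).congr_deriv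
      (by simp only [hb3]; ring)
  have db3 : ∀ u, HasDerivAt b3 (b4 u) u := fun u =>
    ((((d1 u).mul (d2 u)).const_mul 3).add ((d0 u).mul (d3 u))).const_mul 2
  have v1 : ∀ u, deriv^[1] V u = b1 u • deriv^[2] γ u - deriv γ u := fun u => by
    refine ((db0 u).smul (t2 u)).deriv.trans ?_
    rw [smul_neg, smul_smul, hgκ, one_smul]
    abel
  have v2 : ∀ u, deriv^[2] V u
      = (b2 u - 1) • deriv^[2] γ u - (b1 u * κ u) • deriv γ u := fun u => by
    have h := hV.hasDerivAt_iterate_deriv 1 u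
    rw [funext v1] at h
    rw [h.unique (((db1 u).smul (t2 u)).sub (t1 u))]
    module
  have v3 : ∀ u, deriv^[3] V u = (b3 u - b1 u * κ u) • deriv^[2] γ u
      - ((b2 u - 1) * κ u + (b2 u * κ u + b1 u * deriv κ u)) • deriv γ u := fun u => by
    have h := hV.hasDerivAt_iterate_deriv 2 u
    rw [funext v2] at h
    rw [h.unique ((((db2 u).sub_const 1).smul (t2 u)).sub (((db1 u).mul (k0 u)).smul (t1 u)))]
    simp only [Pi.mul_apply]
    module
  have v4 : ∀ u, areaForm (deriv γ u) (deriv^[4] V u) = b4 u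
      - 2 * (b2 u * κ u + b1 u * deriv κ u) - (b2 u - 1) * κ u := fun u => by
    have h := hV.hasDerivAt_iterate_deriv 3 u
    rw [funext v3] at h
    have hq := (db1 u).mul (k0 u)
    have hq1 := ((db2 u).mul (k0 u)).add ((db1 u).mul (k1 u))
    rw [h.unique ((((db3 u).sub hq).smul (t2 u)).sub
      (((((db2 u).sub_const 1).mul (k0 u)).add hq1).smul (t1 u)))]
    have h12 : areaForm (deriv γ u) (deriv^[2] γ u) = 1 := hγ.arcLength u
    simp only [sub_eq_add_neg, areaForm_add_right, areaForm_neg_right, areaForm_smul_right,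
      areaForm_self, h12, Pi.add_apply, Pi.mul_apply]
    ring
  obtain ⟨ε, hε, hΓ⟩ := exists_isDeformation_linear hγ hV hVp
  obtain ⟨V', -, -, hV'd, hF⟩ := hΓ.exists_hasDerivAt_fullAffineLength hγ hε
  have hVV : V' = V := funext fun u => (hV'd u).unique <| by
    simpa using ((hasDerivAt_id (0 : ℝ)).smul_const (V u)).const_add (γ u)
  rw [hVV] at hF
  have hI := hF.unique (H V ε hV hVp hε hΓ)
  -- The bracketed part is the derivative of `2g' + (g b3 - g' b2)/6 + g'³/9`, so only the square
  -- term survives integration over a period.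
  have hint : ∀ u, ((4 * (areaForm (deriv^[2] V u) (deriv^[3] γ u)
        + areaForm (deriv^[2] γ u) (deriv^[3] V u))
      + (areaForm (deriv V u) (deriv^[4] γ u) + areaForm (deriv γ u) (deriv^[4] V u))) / 3
      - κ u * (areaForm (deriv V u) (deriv^[2] γ u) + areaForm (deriv γ u) (deriv^[2] V u)))
      / (2 * √(κ u)) = (2 * g2 u + (g u * b4 u - g2 u * b2 u) / 6 + g1 u ^ 2 * g2 u / 3)
        + g u * g2 u ^ 2 / 3 := fun u => by
    have v1' : deriv V u = b1 u • deriv^[2] γ u - deriv γ u := v1 u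
    have h12 : areaForm (deriv γ u) (deriv^[2] γ u) = 1 := hγ.arcLength u
    have h21 : areaForm (deriv^[2] γ u) (deriv γ u) = -1 := by rw [areaForm_swap, h12]
    have e1 : κ u = (g u ^ 2)⁻¹ := eq_inv_of_mul_eq_one_right (hgκ u)
    have e2 : √(κ u) = (g u)⁻¹ := (inv_inv _).symm
    have e3 : deriv κ u = (g u)⁻¹ * (-2 * g1 u * κ u) := by
      rw [← hκ1, inv_mul_cancel_left₀ (hg0 u).ne']
    rw [v4, v3, v2, v1', h4, deriv_three_of_arcLength hc hγ.arcLength, ← hκdef]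
    simp only [sub_eq_add_neg, areaForm_add_left, areaForm_add_right, areaForm_neg_left,
      areaForm_neg_right, areaForm_smul_left, areaForm_smul_right, areaForm_self, h12, h21]
    rw [e2, e3, e1]
    simp only [hb1, hb2, hb4]
    have := (hg0 u).ne'
    field_simp
    ring
  have cg := hg.continuous
  have cg1 : Continuous g1 := (hg.iterate_deriv 1).continuous
  have cg2 : Continuous g2 := (hg.iterate_deriv 2).continuous
  have cg3 : Continuous g3 := (hg.iterate_deriv 3).continuous
  have cg4 : Continuous g4 := (hg.iterate_deriv 4).continuous
  have cb2 : Continuous b2 := by fun_prop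
  have cb4 : Continuous b4 := by fun_prop
  have hWc : Continuous fun u => 2 * g2 u + (g u * b4 u - g2 u * b2 u) / 6
      + g1 u ^ 2 * g2 u / 3 := by fun_prop
  have hRc : Continuous fun u => g u * g2 u ^ 2 / 3 := by fun_prop
  have hW0 : ∫ u in (0 : ℝ)..L, (2 * g2 u + (g u * b4 u - g2 u * b2 u) / 6
      + g1 u ^ 2 * g2 u / 3) = 0 := by
    refine integral_eq_zero_of_hasDerivAt_periodic
      (W := fun u => 2 * g1 u + (g u * b3 u - g1 u * b2 u) / 6 + g1 u ^ 3 / 9) hWc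
      (fun u => ?_) (fun u => ?_)
    · refine ((((d1 u).const_mul 2).add ((((d0 u).mul (db3 u)).sub
        ((d1 u).mul (db2 u))).div_const 6)).add (((d1 u).pow 3).div_const 9)).congr_deriv ?_
      push_cast; ring
    · have p1 : g1 (u + L) = g1 u := periodic_iterate_deriv hgp 1 u
      have p2 : g2 (u + L) = g2 u := periodic_iterate_deriv hgp 2 u
      have p3 : g3 (u + L) = g3 u := periodic_iterate_deriv hgp 3 u
      simp only [hb2, hb3, p1, p2, p3, hgp u]
  have hR0 : ∫ u in (0 : ℝ)..L, g u * g2 u ^ 2 / 3 = 0 := by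
    have hadd := intervalIntegral.integral_add (hWc.intervalIntegrable (μ := MeasureTheory.volume)
      0 L) (hRc.intervalIntegrable 0 L)
    rw [hW0, zero_add] at hadd
    rw [← hadd]
    refine Eq.trans ?_ hI
    exact intervalIntegral.integral_congr fun u _ => (hint u).symm
  have hg2 : ∀ u ∈ Icc 0 L, g2 u = 0 := by
    intro u hu
    by_contra hne
    have hlt : 0 < ∫ u in (0 : ℝ)..L, g u * g2 u ^ 2 / 3 :=
      intervalIntegral.integral_pos hγ.period_pos hRc.continuousOn
        (fun x _ => by have := hg0 x; positivity)
        ⟨u, hu, by have := hg0 u; positivity⟩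
    exact hlt.ne' hR0
  have hg2' : ∀ u, g2 u = 0 := fun u => by
    obtain ⟨y, hy, he⟩ := (periodic_iterate_deriv hgp 2).exists_mem_Ico₀ hγ.period_pos u
    exact he.trans (hg2 y (Ico_subset_Icc_self hy))
  have hgc := eq_const_of_iterate_deriv_two_eq_zero hγ.period_pos hg hgp hg2' s
  have e : ∀ u, κ u = (g u ^ 2)⁻¹ := fun u => eq_inv_of_mul_eq_one_right (hgκ u)
  rw [e, e, hgc]

/-! ### Scaling removes homogeneous constraints -/

theorem IsDeformation.mono {γ : ℝ → Plane} {L ε δ : ℝ} {Γ : ℝ → ℝ → Plane}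
    (hΓ : IsDeformation γ L ε Γ) (h : δ ≤ ε) : IsDeformation γ L δ Γ := by
  have hI : Ioo (-δ) δ ⊆ Ioo (-ε) ε := Ioo_subset_Ioo (neg_le_neg h) h
  exact ⟨hΓ.smooth.mono (prod_mono hI subset_rfl), hΓ.start, fun t ht => hΓ.closed t (hI ht),
    fun t ht => hΓ.nondegenerate t (hI ht), fun t ht => hΓ.curvature_pos t (hI ht)⟩

theorem IsDeformation.smul {γ : ℝ → Plane} {L ε : ℝ} {Γ : ℝ → ℝ → Plane} {k : ℝ → ℝ}
    (hΓ : IsDeformation γ L ε Γ) (hk : ContDiffOn ℝ ∞ k (Ioo (-ε) ε)) (hk0 : k 0 = 1)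
    (hpos : ∀ t ∈ Ioo (-ε) ε, 0 < k t) : IsDeformation γ L ε fun t u => k t • Γ t u where
  smooth := (hk.comp contDiffOn_fst fun p hp => hp.1).smul hΓ.smooth
  start := by simp [hk0, hΓ.start]
  closed t ht u := by simp only [hΓ.closed t ht u]
  nondegenerate t ht u :=
    areaForm_deriv_const_smul_pos (hΓ.contDiff ht) (hpos t ht) (hΓ.nondegenerate t ht u)
  curvature_pos t ht u :=
    affineCurvature_const_smul_pos (hΓ.contDiff ht) (hpos t ht) (hΓ.nondegenerate t ht)
      (hΓ.curvature_pos t ht u)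

/-- Multiply `Γ t` by `(G (Γ t) / G γ)^(-1/p)`. The new deformation keeps `G` fixed, since `G` has
degree `p`, and has the same `fullAffineLength`, so constrained criticality controls every
deformation. The interval is shrunk until the ratio is positive. -/
theorem IsCriticalPointUnder.hasDerivAt_zero {G : (ℝ → Plane) → ℝ → ℝ} {p : ℝ} (hp : p ≠ 0)
    {γ : ℝ → Plane} {L : ℝ} (hcrit : IsCriticalPointUnder fullAffineLength G γ L)
    (hG : G γ L ≠ 0)
    (hscale : ∀ (c : ℝ → Plane) (k : ℝ), ContDiff ℝ ∞ c →
      (∀ u, 0 < areaForm (deriv c u) (deriv (deriv c) u)) → 0 < k →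
      G (fun u => k • c u) L = k ^ p * G c L)
    {ε : ℝ} {Γ : ℝ → ℝ → Plane} (hε : 0 < ε) (hΓ : IsDeformation γ L ε Γ)
    (hGs : ContDiffOn ℝ ∞ (fun t => G (Γ t) L) (Ioo (-ε) ε)) :
    HasDerivAt (fun t => fullAffineLength (Γ t) L) 0 0 := by
  have h0 : (0 : ℝ) ∈ Ioo (-ε) ε := by simpa using hε
  set r : ℝ → ℝ := fun t => G (Γ t) L / G γ L with hr
  have hrs : ContDiffOn ℝ ∞ r (Ioo (-ε) ε) := hGs.div_const _
  have hr0 : r 0 = 1 := by simp only [hr, hΓ.start, div_self hG]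
  have hev : ∀ᶠ t in nhds (0 : ℝ), 0 < r t :=
    (hrs.continuousOn.continuousAt (isOpen_Ioo.mem_nhds h0)).eventually
      (lt_mem_nhds (by rw [hr0]; exact one_pos))
  obtain ⟨δ₀, hδ₀, hδr⟩ := Metric.eventually_nhds_iff.1 hev
  obtain ⟨δ, hδ, hδε, hδδ⟩ : ∃ δ > 0, δ ≤ ε ∧ δ ≤ δ₀ :=
    ⟨min ε δ₀, lt_min hε hδ₀, min_le_left _ _, min_le_right _ _⟩
  have hI : Ioo (-δ) δ ⊆ Ioo (-ε) ε := Ioo_subset_Ioo (neg_le_neg hδε) hδε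
  have hrpos : ∀ t ∈ Ioo (-δ) δ, 0 < r t := fun t ht =>
    hδr (by rw [Real.dist_eq, sub_zero]; exact (abs_lt.2 ht).trans_le hδδ)
  have hΓδ := hΓ.mono hδε
  have hkpos : ∀ t ∈ Ioo (-δ) δ, 0 < r t ^ (-p⁻¹) := fun t ht =>
    Real.rpow_pos_of_pos (hrpos t ht) _
  have hdef : IsDeformation γ L δ fun t u => r t ^ (-p⁻¹) • Γ t u :=
    hΓδ.smul ((hrs.mono hI).rpow_const_of_ne fun t ht => (hrpos t ht).ne')
      (by rw [hr0, Real.one_rpow]) hkpos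
  refine (hcrit δ _ hδ hdef fun t ht => ?_).congr_of_eventuallyEq ?_
  · rw [hscale _ _ (hΓδ.contDiff ht) (hΓδ.nondegenerate t ht) (hkpos t ht),
      ← Real.rpow_mul (hrpos t ht).le, neg_mul, inv_mul_cancel₀ hp, Real.rpow_neg_one]
    have hne : G (Γ t) L ≠ 0 := fun h => (hrpos t ht).ne' (by simp only [hr, h, zero_div])
    simp only [hr]
    field_simp
  · filter_upwards [isOpen_Ioo.mem_nhds (show (0 : ℝ) ∈ Ioo (-δ) δ by simpa using hδ)] with t ht
    exact (fullAffineLength_const_smul (hΓδ.contDiff ht) (hkpos t ht)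
      (hΓδ.nondegenerate t ht) L).symm

/-! ### Self-intersections of locally convex curves of higher turning number -/

/-- A plane curve parametrised by its tangent angle that, after one full turn, comes back to the
same height and not further back, has a double point. -/
theorem exists_double_point_of_full_turn {x y ρ : ℝ → ℝ} (hρ : ∀ φ, 0 < ρ φ)
    (hx : ∀ φ, HasDerivAt x (ρ φ * Real.cos φ) φ) (hy : ∀ φ, HasDerivAt y (ρ φ * Real.sin φ) φ)
    (hy0 : y (2 * Real.pi) = y 0) (hx0 : x 0 ≤ x (2 * Real.pi)) :
    ∃ a b, 0 ≤ a ∧ a < b ∧ b ≤ 2 * Real.pi ∧ x a = x b ∧ y a = y b := by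
  have hπ := Real.pi_pos
  have cx : Continuous x := continuous_iff_continuousAt.2 fun φ => (hx φ).continuousAt
  have cy : Continuous y := continuous_iff_continuousAt.2 fun φ => (hy φ).continuousAt
  have hup : StrictMonoOn y (Icc 0 Real.pi) := by
    refine strictMonoOn_of_deriv_pos (convex_Icc _ _) cy.continuousOn fun φ hφ => ?_
    rw [interior_Icc] at hφ
    rw [(hy φ).deriv]
    exact mul_pos (hρ φ) (Real.sin_pos_of_pos_of_lt_pi hφ.1 hφ.2)
  have hdown : StrictAntiOn y (Icc Real.pi (2 * Real.pi)) := by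
    refine strictAntiOn_of_deriv_neg (convex_Icc _ _) cy.continuousOn fun φ hφ => ?_
    rw [interior_Icc] at hφ
    rw [(hy φ).deriv]
    refine mul_neg_of_pos_of_neg (hρ φ) ?_
    have h := Real.sin_pos_of_pos_of_lt_pi (x := φ - Real.pi) (by linarith [hφ.1])
      (by linarith [hφ.2])
    rw [Real.sin_sub_pi] at h
    linarith
  have hback : StrictAntiOn x (Icc (Real.pi / 2) (3 * Real.pi / 2)) := by
    refine strictAntiOn_of_deriv_neg (convex_Icc _ _) cx.continuousOn fun φ hφ => ?_
    rw [interior_Icc] at hφ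
    rw [(hx φ).deriv]
    exact mul_neg_of_pos_of_neg (hρ φ)
      (Real.cos_neg_of_pi_div_two_lt_of_lt hφ.1 (by linarith [hφ.2]))
  have hpartner : ∀ a ∈ Icc 0 Real.pi, ∃ b ∈ Icc Real.pi (2 * Real.pi), y b = y a := by
    intro a ha
    have h := intermediate_value_Icc' (by linarith : Real.pi ≤ 2 * Real.pi) cy.continuousOn
    obtain ⟨b, hb, he⟩ := h (show y a ∈ Icc (y (2 * Real.pi)) (y Real.pi) from
      ⟨by rw [hy0]; exact hup.monotoneOn ⟨le_rfl, hπ.le⟩ ha ha.1,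
        hup.monotoneOn ha ⟨hπ.le, le_rfl⟩ ha.2⟩)
    exact ⟨b, hb, he⟩
  -- Pairs of points at equal height on the ascending and the descending branch.
  set K : Set (ℝ × ℝ) := (Icc 0 Real.pi ×ˢ Icc Real.pi (2 * Real.pi)) ∩ {p | y p.2 = y p.1} with hK
  have hKc : IsCompact K := (isCompact_Icc.prod isCompact_Icc).inter_right
    (isClosed_eq (cy.comp continuous_snd) (cy.comp continuous_fst))
  -- `S` and `S'` collect the ascending parameters whose partner at equal height lies weakly to the
  -- right, respectively to the left. Both are closed and together they cover `[0, π]`. By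
  -- connectedness they meet, and uniqueness of the partner turns the two inequalities into a double
  -- point.
  set S : Set ℝ := Prod.fst '' (K ∩ {p | x p.1 ≤ x p.2}) with hS
  set S' : Set ℝ := Prod.fst '' (K ∩ {p | x p.2 ≤ x p.1}) with hS'
  have hSc : IsClosed S := ((hKc.inter_right (isClosed_le (cx.comp continuous_fst)
    (cx.comp continuous_snd))).image continuous_fst).isClosed
  have hSc' : IsClosed S' := ((hKc.inter_right (isClosed_le (cx.comp continuous_snd)
    (cx.comp continuous_fst))).image continuous_fst).isClosed
  have hcov : Icc 0 Real.pi ⊆ S ∪ S' := fun a ha => by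
    obtain ⟨b, hb, he⟩ := hpartner a ha
    rcases le_total (x a) (x b) with h | h
    · exact Or.inl ⟨(a, b), ⟨⟨⟨ha, hb⟩, he⟩, h⟩, rfl⟩
    · exact Or.inr ⟨(a, b), ⟨⟨⟨ha, hb⟩, he⟩, h⟩, rfl⟩
  -- At `π` the pair degenerates to a single point, so a member of `S'` below `π` is needed. The
  -- higher of the points at `π/2` and `3π/2` has its partner inside `[π/2, 3π/2]`, where `x`
  -- decreases.
  obtain ⟨m, hm, hmS⟩ : ∃ m ∈ Ico 0 Real.pi, m ∈ S' := by
    rcases le_total (y (3 * Real.pi / 2)) (y (Real.pi / 2)) with h | h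
    · obtain ⟨b, hb, he⟩ := hpartner (Real.pi / 2) ⟨by linarith, by linarith⟩
      have hb' : b ≤ 3 * Real.pi / 2 := by
        by_contra hlt
        have := hdown (a := 3 * Real.pi / 2) (b := b) ⟨by linarith, by linarith⟩ hb (not_le.1 hlt)
        linarith
      refine ⟨Real.pi / 2, ⟨by linarith, by linarith⟩, (Real.pi / 2, b),
        ⟨⟨⟨⟨by simp only; linarith, by simp only; linarith⟩, hb⟩, he⟩, ?_⟩, rfl⟩
      exact (hback.antitoneOn ⟨le_rfl, by linarith⟩ ⟨by linarith [hb.1], hb'⟩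
        (by linarith [hb.1]))
    · have h2 := intermediate_value_Icc (by linarith : Real.pi / 2 ≤ Real.pi)
        cy.continuousOn
      obtain ⟨a, ha, he⟩ := h2 (show y (3 * Real.pi / 2) ∈ Icc (y (Real.pi / 2)) (y Real.pi) from
        ⟨h, hdown.antitoneOn ⟨le_rfl, by linarith⟩ ⟨by linarith, by linarith⟩ (by linarith)⟩)
      have ha' : a ∈ Icc 0 Real.pi := ⟨by linarith [ha.1], ha.2⟩
      refine ⟨a, ⟨ha'.1, ha'.2.lt_of_ne ?_⟩, (a, 3 * Real.pi / 2),
        ⟨⟨⟨ha', by constructor <;> simp only <;> linarith⟩, he.symm⟩, ?_⟩, rfl⟩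
      · rintro rfl
        have := hdown (a := Real.pi) (b := 3 * Real.pi / 2) ⟨le_rfl, by linarith⟩
          ⟨by linarith, by linarith⟩ (by linarith)
        linarith
      exact (hback.antitoneOn ⟨ha.1, by linarith [ha.2]⟩ ⟨by linarith, le_rfl⟩
        (by linarith [ha.2]))
  have hsub : Icc 0 m ⊆ Icc 0 Real.pi := Icc_subset_Icc_right hm.2.le
  have h0S : (0 : ℝ) ∈ S := ⟨(0, 2 * Real.pi), ⟨⟨⟨⟨le_rfl, hπ.le⟩, by constructor <;> simp only <;>
    linarith⟩, hy0⟩, hx0⟩, rfl⟩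
  obtain ⟨a, ham, ⟨⟨a₁, b⟩, ⟨⟨⟨ha, hb⟩, he⟩, hab⟩, rfl⟩, ⟨⟨a₂, b'⟩, ⟨⟨⟨-, hb'⟩, he'⟩, hab'⟩, h12⟩⟩ :=
    isPreconnected_closed_iff.1 isPreconnected_Icc S S' hSc hSc' (hsub.trans hcov)
      ⟨0, ⟨le_rfl, hm.1⟩, h0S⟩ ⟨m, ⟨hm.1, le_rfl⟩, hmS⟩
  simp only [mem_ofPred_eq] at he hab he' hab' h12 ha hb hb' ham
  subst h12
  obtain rfl : b = b' := hdown.injOn hb hb' (he.trans he'.symm)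
  exact ⟨a₂, b, ha.1, (ham.2.trans_lt hm.2).trans_le hb.1, hb.2, le_antisymm hab hab', he.symm⟩

/-- A closed curve parametrised by its tangent angle whose turning number is at least `2` has a
double point. -/
theorem exists_double_point_of_two_le_turning {x y ρ : ℝ → ℝ} {m : ℕ} (hm : 2 ≤ m)
    (hρ : ∀ φ, 0 < ρ φ)
    (hx : ∀ φ, HasDerivAt x (ρ φ * Real.cos φ) φ) (hy : ∀ φ, HasDerivAt y (ρ φ * Real.sin φ) φ)
    (hxp : Function.Periodic x (m * (2 * Real.pi))) (hyp : Function.Periodic y (m * (2 * Real.pi))) :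
    ∃ a b, a < b ∧ b < a + m * (2 * Real.pi) ∧ x a = x b ∧ y a = y b := by
  have hπ := Real.pi_pos
  -- `p` is the support function, the position along the normal at angle `φ`, and `q` is the
  -- position along the tangent. The velocity is tangential, hence `p' = q`.
  set p : ℝ → ℝ := fun φ => x φ * Real.sin φ - y φ * Real.cos φ with hp
  set q : ℝ → ℝ := fun φ => x φ * Real.cos φ + y φ * Real.sin φ with hq
  have hpq : ∀ φ, HasDerivAt p (q φ) φ := fun φ =>
    (((hx φ).mul (Real.hasDerivAt_sin φ)).sub ((hy φ).mul (Real.hasDerivAt_cos φ))).congr_deriv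
      (by simp only [hq]; ring)
  have hpp : Function.Periodic p (m * (2 * Real.pi)) := fun φ => by
    simp only [hp, hxp φ, hyp φ, Real.sin_add_nat_mul_two_pi, Real.cos_add_nat_mul_two_pi]
  -- `d` is the normal displacement after one full turn. A zero of `d` with `q` not decreasing over
  -- that turn is the situation of `exists_double_point_of_full_turn`, up to a rotation.
  set d : ℝ → ℝ := fun φ => p (φ + 2 * Real.pi) - p φ with hd
  have hdd : ∀ φ, HasDerivAt d (q (φ + 2 * Real.pi) - q φ) φ := fun φ =>
    ((hpq _).comp_add_const φ (2 * Real.pi)).sub (hpq φ)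
  have hdp : Function.Periodic d (m * (2 * Real.pi)) := fun φ => by
    simp only [hd]
    rw [hpp φ, add_right_comm, hpp]
  have hsum : ∀ φ, ∑ j ∈ Finset.range m, d (φ + j * (2 * Real.pi)) = 0 := fun φ => by
    have h := Finset.sum_range_sub (fun j : ℕ => p (φ + j * (2 * Real.pi))) m
    rw [hpp φ] at h
    simp only [Nat.cast_zero, zero_mul, add_zero, sub_self] at h
    rw [← h]
    refine Finset.sum_congr rfl fun j _ => ?_
    simp only [hd]
    push_cast
    ring_nf
  have hmem : (Finset.range m).Nonempty := ⟨0, Finset.mem_range.2 (by omega)⟩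
  obtain ⟨φ₀, hd0, hq0⟩ : ∃ φ, d φ = 0 ∧ q φ ≤ q (φ + 2 * Real.pi) := by
    -- Otherwise `d' < 0` at every zero of `d`. Sums of `d` over `m` successive turns telescope to
    -- zero, so `d ≤ 0` somewhere, and from there on `d` cannot become positive. The vanishing sums
    -- then force `d = 0` on a half-line, contradicting `d' < 0` at zeros.
    by_contra! hcon
    obtain ⟨φ₁, h₁⟩ : ∃ φ, d φ ≤ 0 := by
      by_contra! hpos
      have := Finset.sum_pos (fun j (_ : j ∈ Finset.range m) => hpos (0 + j * (2 * Real.pi))) hmem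
      exact this.ne' (hsum 0)
    have hle : ∀ φ ≥ φ₁, d φ ≤ 0 := fun φ hφ =>
      image_le_of_deriv_right_lt_deriv_boundary (f := d) (B := fun _ => 0) (B' := fun _ => 0)
        (fun z _ => (hdd z).continuousAt.continuousWithinAt)
        (fun z _ => (hdd z).hasDerivWithinAt) h₁ (fun z => hasDerivAt_const z 0)
        (fun z _ hz => sub_neg.2 (hcon z hz)) ⟨hφ, le_rfl⟩
    have hzero : ∀ φ ≥ φ₁, d φ = 0 := fun φ hφ => by
      have h := (Finset.sum_eq_zero_iff_of_nonpos (fun j (_ : j ∈ Finset.range m) =>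
        hle (φ + j * (2 * Real.pi)) (by have : (0:ℝ) ≤ j * (2 * Real.pi) := by positivity
                                        linarith))).1 (hsum φ) 0 (Finset.mem_range.2 (by omega))
      simpa using h
    have h1 := hdd (φ₁ + 1)
    have h2 : d =ᶠ[nhds (φ₁ + 1)] fun _ => 0 := by
      filter_upwards [lt_mem_nhds (show φ₁ < φ₁ + 1 by linarith)] with z hz
      exact hzero z hz.le
    have h3 := h1.unique ((hasDerivAt_const _ (0 : ℝ)).congr_of_eventuallyEq h2)
    linarith [hcon (φ₁ + 1) (hzero _ (by linarith))]
  -- Rotating by `-φ₀` and shifting the parameter makes the tangent direction at `φ₀` horizontal.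
  obtain ⟨a, b, ha, hab, hb, hxe, hye⟩ := exists_double_point_of_full_turn
    (x := fun φ => x (φ + φ₀) * Real.cos φ₀ + y (φ + φ₀) * Real.sin φ₀)
    (y := fun φ => y (φ + φ₀) * Real.cos φ₀ - x (φ + φ₀) * Real.sin φ₀)
    (ρ := fun φ => ρ (φ + φ₀)) (fun φ => hρ _)
    (fun φ => ((((hx _).comp_add_const φ φ₀).mul_const _).add
      (((hy _).comp_add_const φ φ₀).mul_const _)).congr_deriv (by
        have h := Real.cos_sub (φ + φ₀) φ₀
        rw [add_sub_cancel_right] at h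
        rw [h]; ring))
    (fun φ => ((((hy _).comp_add_const φ φ₀).mul_const _).sub
      (((hx _).comp_add_const φ φ₀).mul_const _)).congr_deriv (by
        have h := Real.sin_sub (φ + φ₀) φ₀
        rw [add_sub_cancel_right] at h
        rw [h]; ring))
    (by
      simp only [hd, hp, Real.sin_add_two_pi, Real.cos_add_two_pi] at hd0
      simp only [zero_add, add_comm (2 * Real.pi) φ₀]
      linarith)
    (by
      simp only [hq, Real.sin_add_two_pi, Real.cos_add_two_pi] at hq0
      simp only [zero_add, add_comm (2 * Real.pi) φ₀]
      exact hq0)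
  have hm' : (2 : ℝ) ≤ m := by exact_mod_cast hm
  have hsc := Real.sin_sq_add_cos_sq φ₀
  -- Since `m ≥ 2`, a full turn is shorter than the period, so this double point is not the closing
  -- of the curve.
  refine ⟨a + φ₀, b + φ₀, by linarith, by nlinarith, ?_, ?_⟩
  · linear_combination Real.cos φ₀ * hxe - Real.sin φ₀ * hye - (x (a + φ₀) - x (b + φ₀)) * hsc
  · linear_combination Real.sin φ₀ * hxe + Real.cos φ₀ * hye - (y (a + φ₀) - y (b + φ₀)) * hsc

/-! ### Simple closed locally convex curves enclose positive area -/

/-- Regard `γ'` as a complex function `z` and integrate `z'/z` to a logarithm `W`; the angle is `Im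
W`. Its derivative is `|γ', γ''|` divided by the squared Euclidean norm of `γ'`, hence positive.
Periodicity of `z` makes the increment of the angle over a period a multiple of `2π`, positive by
monotonicity. -/
theorem exists_tangentAngle {γ : ℝ → Plane} {L : ℝ} (hγ : IsSimpleClosedPositivelyCurved γ L) :
    ∃ (θ r : ℝ → ℝ) (m : ℕ), 0 < m ∧ (∀ s, 0 < r s) ∧ (∀ s, ∃ θ' > 0, HasDerivAt θ θ' s) ∧
      (∀ s, θ (s + L) = θ s + m * (2 * Real.pi)) ∧
      ∀ s, deriv γ s = (r s * Real.cos (θ s), r s * Real.sin (θ s)) := by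
  have hc := hγ.smooth
  set z : ℝ → ℂ := fun s => ⟨(deriv γ s).1, (deriv γ s).2⟩ with hz
  set z' : ℝ → ℂ := fun s => ⟨(deriv^[2] γ s).1, (deriv^[2] γ s).2⟩ with hz'
  have hcont : ∀ k, Continuous fun s => (⟨(deriv^[k] γ s).1, (deriv^[k] γ s).2⟩ : ℂ) := fun k =>
    Complex.equivRealProdCLM.symm.continuous.comp (hc.iterate_deriv k).continuous
  have hzd : ∀ s, HasDerivAt z (z' s) s := fun s =>
    Complex.equivRealProdCLM.symm.toContinuousLinearMap.hasFDerivAt.comp_hasDerivAt s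
      (hc.hasDerivAt_iterate_deriv 1 s)
  have hz0 : ∀ s, z s ≠ 0 := fun s h => by
    have h1 := hγ.arcLength s
    have e1 : (deriv γ s).1 = 0 := congrArg Complex.re h
    have e2 : (deriv γ s).2 = 0 := congrArg Complex.im h
    simp [areaForm, e1, e2] at h1
  have hq : Continuous fun s => z' s / z s := (hcont 2).div (hcont 1) hz0
  set W : ℝ → ℂ := fun s => Complex.log (z 0) + ∫ t in (0 : ℝ)..s, z' t / z t with hW
  have hWd : ∀ s, HasDerivAt W (z' s / z s) s := fun s =>
    (hq.integral_hasStrictDerivAt 0 s).hasDerivAt.const_add _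
  have hexp : ∀ s, z s = Complex.exp (W s) := by
    have hd : ∀ s, HasDerivAt (fun s => z s * Complex.exp (-W s)) 0 s := fun s => by
      refine ((hzd s).mul (hWd s).neg.cexp).congr_deriv ?_
      have := hz0 s
      field_simp
      ring
    intro s
    have h := is_const_of_deriv_eq_zero (fun s => (hd s).differentiableAt)
      (fun s => (hd s).deriv) s 0
    have hW0 : W 0 = Complex.log (z 0) := by simp [hW]
    rw [hW0, Complex.exp_neg, Complex.exp_neg, Complex.exp_log (hz0 0),
      mul_inv_cancel₀ (hz0 0)] at h
    exact (mul_inv_eq_one₀ (Complex.exp_ne_zero _)).1 h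
  have hθd : ∀ s, HasDerivAt (fun s => (W s).im) (z' s / z s).im s := fun s =>
    Complex.imCLM.hasFDerivAt.comp_hasDerivAt s (hWd s)
  have hθpos : ∀ s, 0 < (z' s / z s).im := fun s => by
    have h1 : areaForm (deriv γ s) (deriv^[2] γ s) = 1 := hγ.arcLength s
    have h2 : 0 < Complex.normSq (z s) := Complex.normSq_pos.2 (hz0 s)
    have h3 : (z' s / z s).im = areaForm (deriv γ s) (deriv^[2] γ s) / Complex.normSq (z s) := by
      rw [Complex.div_im, areaForm]
      simp only [hz, hz']
      ring
    rw [h3, h1]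
    positivity
  have hzp : ∀ s, z (s + L) = z s := fun s => by
    simp only [hz, periodic_deriv hγ.closed s]
  have hzp' : ∀ s, z' (s + L) = z' s := fun s => by
    simp only [hz', periodic_iterate_deriv hγ.closed 2 s]
  have hmono : StrictMono fun s => (W s).im :=
    strictMono_of_deriv_pos fun s => by rw [(hθd s).deriv]; exact hθpos s
  have hshift : ∀ s, W (s + L) - W s = W L - W 0 := fun s => by
    have hd : ∀ s, HasDerivAt (fun s => W (s + L) - W s) 0 s := fun s => by
      refine (((hWd (s + L)).comp_add_const s L).sub (hWd s)).congr_deriv ?_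
      rw [hzp, hzp', sub_self]
    have h := is_const_of_deriv_eq_zero (fun s => (hd s).differentiableAt)
      (fun s => (hd s).deriv) s 0
    simpa using h
  obtain ⟨n, hn⟩ : ∃ n : ℤ, W L = W 0 + n * (2 * Real.pi * Complex.I) := by
    rw [← Complex.exp_eq_exp_iff_exists_int, ← hexp, ← hexp]
    simpa using hzp 0
  have him : ∀ s, (W (s + L)).im = (W s).im + n * (2 * Real.pi) := fun s => by
    have h := hshift s
    rw [hn, add_sub_cancel_left, sub_eq_iff_eq_add'] at h
    rw [h]
    simp
  have hnpos : 0 < n := by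
    have h := hmono (show (0 : ℝ) < 0 + L by simpa using hγ.period_pos)
    simp only [him, lt_add_iff_pos_right] at h
    have := Real.pi_pos
    exact_mod_cast (mul_pos_iff_of_pos_right (by positivity)).1 h
  lift n to ℕ using hnpos.le
  refine ⟨fun s => (W s).im, fun s => Real.exp (W s).re, n, by exact_mod_cast hnpos,
    fun s => Real.exp_pos _, fun s => ⟨_, hθpos s, hθd s⟩, fun s => by simpa using him s,
    fun s => ?_⟩
  have h := hexp s
  exact Prod.ext ((congrArg Complex.re h).trans (Complex.exp_re _))
    ((congrArg Complex.im h).trans (Complex.exp_im _))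

theorem IsSimpleClosedPositivelyCurved.not_eq_of_lt {γ : ℝ → Plane} {L : ℝ}
    (hγ : IsSimpleClosedPositivelyCurved γ L) {a b : ℝ} (hab : a < b) (hb : b < a + L) :
    γ a ≠ γ b := by
  intro h
  obtain ⟨n, hn, -⟩ := existsUnique_sub_zsmul_mem_Ico hγ.period_pos a 0
  have hp : ∀ s, γ (s - n • L) = γ s := fun s => hγ.closed.sub_zsmul_eq n
  rw [zero_add] at hn
  rw [← hp a, ← hp b] at h
  set a' := a - n • L
  have hab' : a' < b - n • L := by linarith
  have hb' : b - n • L < a' + L := by simp only [a']; linarith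
  set b' := b - n • L
  rcases lt_or_ge b' L with hlt | hge
  · exact hab'.ne (hγ.simple hn ⟨hn.1.trans hab'.le, hlt⟩ h)
  · rw [← hγ.closed.sub_eq b'] at h
    have := hγ.simple hn (show b' - L ∈ Ico 0 L from ⟨by linarith, by linarith [hn.2]⟩) h
    linarith

/-- The angle is an increasing bijection of the line, so it serves as parameter. The speed then
becomes the Euclidean radius of curvature, and the period `L` becomes `m` full turns. For `m ≥ 2`
the resulting double point contradicts simplicity. -/
theorem turning_eq_one {γ : ℝ → Plane} {L : ℝ} (hγ : IsSimpleClosedPositivelyCurved γ L)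
    {θ r : ℝ → ℝ} {m : ℕ} (hm : 0 < m) (hr : ∀ s, 0 < r s)
    (hθ : ∀ s, ∃ θ' > 0, HasDerivAt θ θ' s)
    (hp : ∀ s, θ (s + L) = θ s + m * (2 * Real.pi))
    (hT : ∀ s, deriv γ s = (r s * Real.cos (θ s), r s * Real.sin (θ s))) : m = 1 := by
  by_contra hne
  have hm2 : 2 ≤ m := by omega
  choose θ' hθ'pos hθ' using hθ
  have hc := hγ.smooth
  have hmono : StrictMono θ :=
    strictMono_of_deriv_pos fun s => by rw [(hθ' s).deriv]; exact hθ'pos s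
  have hcont : Continuous θ := continuous_iff_continuousAt.2 fun s => (hθ' s).continuousAt
  have hm0 : (0 : ℝ) < m * (2 * Real.pi) := by have := Real.pi_pos; positivity
  have hnat : ∀ k : ℕ, ∀ s, θ (s + k * L) = θ s + k * (m * (2 * Real.pi)) := fun k s => by
    induction k with
    | zero => simp
    | succ k ih =>
      rw [show s + ((k + 1 : ℕ) : ℝ) * L = s + k * L + L by push_cast; ring, hp, ih]
      push_cast; ring
  have hsurj : Function.Surjective θ := fun v => by
    refine mem_range_of_exists_le_of_exists_ge hcont ?_ ?_
    · obtain ⟨k, hk⟩ := exists_nat_ge ((θ 0 - v) / (m * (2 * Real.pi)))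
      refine ⟨0 - k * L, ?_⟩
      have h := hnat k (0 - k * L)
      rw [sub_add_cancel] at h
      rw [div_le_iff₀ hm0] at hk
      linarith
    · obtain ⟨k, hk⟩ := exists_nat_ge ((v - θ 0) / (m * (2 * Real.pi)))
      refine ⟨0 + k * L, ?_⟩
      rw [div_le_iff₀ hm0] at hk
      linarith [hnat k 0]
  set e := hmono.orderIsoOfSurjective θ hsurj with he
  have hes : ∀ φ, θ (e.symm φ) = φ := fun φ => e.apply_symm_apply φ
  have hse : ∀ s, e.symm (θ s) = s := fun s => e.symm_apply_apply s
  have hed : ∀ φ, HasDerivAt (fun φ => e.symm φ) (θ' (e.symm φ))⁻¹ φ := fun φ =>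
    (hθ' (e.symm φ)).of_local_left_inverse e.symm.continuous.continuousAt (hθ'pos _).ne'
      (Filter.Eventually.of_forall hes)
  have hep : ∀ φ, e.symm (φ + m * (2 * Real.pi)) = e.symm φ + L := fun φ => by
    rw [← hse (e.symm φ + L), hp, hes]
  have hγd : ∀ φ, HasDerivAt (fun φ => γ (e.symm φ))
      ((θ' (e.symm φ))⁻¹ • deriv γ (e.symm φ)) φ := fun φ =>
    HasDerivAt.scomp φ (hc.hasDerivAt_iterate_deriv 0 (e.symm φ)) (hed φ)
  obtain ⟨a, b, hab, hb, hx, hy⟩ := exists_double_point_of_two_le_turning (m := m) hm2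
    (x := fun φ => (γ (e.symm φ)).1) (y := fun φ => (γ (e.symm φ)).2)
    (ρ := fun φ => (θ' (e.symm φ))⁻¹ * r (e.symm φ))
    (fun φ => mul_pos (inv_pos.2 (hθ'pos _)) (hr _))
    (fun φ => ((ContinuousLinearMap.fst ℝ ℝ ℝ).hasFDerivAt.comp_hasDerivAt φ (hγd φ)).congr_deriv
      (by simp [hT, hes, mul_assoc]))
    (fun φ => ((ContinuousLinearMap.snd ℝ ℝ ℝ).hasFDerivAt.comp_hasDerivAt φ (hγd φ)).congr_deriv
      (by simp [hT, hes, mul_assoc]))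
    (fun φ => by simp only [hep, hγ.closed _]) (fun φ => by simp only [hep, hγ.closed _])
  refine hγ.not_eq_of_lt (e.symm.strictMono hab) ?_ (Prod.ext hx hy)
  rw [← hep]
  exact e.symm.strictMono hb

/-- As a function of `t`, the height over the tangent at `s` has the sign of `sin (θ t - θ s)` as
the sign of its derivative. With turning number `1` it rises for half a turn, then falls, and it
vanishes at both ends of the period. -/
theorem areaForm_deriv_chord_pos {γ : ℝ → Plane} {L : ℝ}
    (hγ : IsSimpleClosedPositivelyCurved γ L) {s t : ℝ} (hs : s < t) (ht : t < s + L) :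
    0 < areaForm (deriv γ s) (γ t - γ s) := by
  obtain ⟨θ, r, m, hm, hr, hθ, hp, hT⟩ := exists_tangentAngle hγ
  obtain rfl := turning_eq_one hγ hm hr hθ hp hT
  choose θ' hθ'pos hθ' using hθ
  have hπ := Real.pi_pos
  have hmono : StrictMono θ :=
    strictMono_of_deriv_pos fun s => by rw [(hθ' s).deriv]; exact hθ'pos s
  have hcont : Continuous θ := continuous_iff_continuousAt.2 fun s => (hθ' s).continuousAt
  have hpL : θ (s + L) = θ s + 2 * Real.pi := by simpa using hp s
  set h : ℝ → ℝ := fun t => areaForm (deriv γ s) (γ t - γ s) with hh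
  have hd : ∀ t, HasDerivAt h (r s * r t * Real.sin (θ t - θ s)) t := fun t => by
    refine ((hasDerivAt_const t (deriv γ s)).areaForm
      ((hγ.smooth.hasDerivAt_iterate_deriv 0 t).sub_const (γ s))).congr_deriv ?_
    change areaForm 0 _ + areaForm (deriv γ s) (deriv γ t) = _
    rw [hT, hT, Real.sin_sub]
    simp only [areaForm, Prod.fst_zero, Prod.snd_zero]
    ring
  have hc : Continuous h := continuous_iff_continuousAt.2 fun t => (hd t).continuousAt
  obtain ⟨c, hc1, hcθ⟩ := intermediate_value_Icc (by linarith [hγ.period_pos] : s ≤ s + L)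
    hcont.continuousOn (show θ s + Real.pi ∈ _ from ⟨by linarith, by linarith⟩)
  have hup : StrictMonoOn h (Icc s c) := by
    refine strictMonoOn_of_deriv_pos (convex_Icc _ _) hc.continuousOn fun x hx => ?_
    rw [interior_Icc] at hx
    rw [(hd x).deriv]
    exact mul_pos (mul_pos (hr _) (hr _)) (Real.sin_pos_of_pos_of_lt_pi
      (by linarith [hmono hx.1]) (by linarith [hmono hx.2]))
  have hdown : StrictAntiOn h (Icc c (s + L)) := by
    refine strictAntiOn_of_deriv_neg (convex_Icc _ _) hc.continuousOn fun x hx => ?_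
    rw [interior_Icc] at hx
    rw [(hd x).deriv]
    refine mul_neg_of_pos_of_neg (mul_pos (hr _) (hr _)) ?_
    have h := Real.sin_pos_of_pos_of_lt_pi (x := θ x - θ s - Real.pi)
      (by linarith [hmono hx.1]) (by linarith [hmono hx.2])
    rw [Real.sin_sub_pi] at h
    linarith
  have h0 : h s = 0 := by simp [hh, areaForm]
  have hL : h (s + L) = 0 := by simp [hh, areaForm, hγ.closed s]
  rcases le_total t c with htc | htc
  · have := hup ⟨le_rfl, hc1.1⟩ ⟨hs.le, htc⟩ hs
    rwa [h0] at this
  · have := hdown ⟨htc, ht.le⟩ ⟨hc1.2, le_rfl⟩ ht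
    rwa [hL] at this

/-- Measure the area from the point `γ 0`: the correction `|γ 0, γ'|` is exact, and the rest of the
integrand is positive by the chord inequality, since `γ L = γ 0`. -/
theorem enclosedArea_pos {γ : ℝ → Plane} {L : ℝ} (hγ : IsSimpleClosedPositivelyCurved γ L) :
    0 < enclosedArea γ L := by
  have hc := hγ.smooth
  have hγ1 : Continuous (deriv γ) := (hc.iterate_deriv 1).continuous
  have e1 : Continuous fun s => areaForm (γ 0) (deriv γ s) :=
    (contDiff_const.areaForm (hc.iterate_deriv 1)).continuous
  have e2 : Continuous fun s => areaForm (deriv γ s) (γ 0 - γ s) :=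
    ((hc.iterate_deriv 1).areaForm (contDiff_const.sub hc)).continuous
  have h1 : ∫ s in (0 : ℝ)..L, areaForm (γ 0) (deriv γ s) = 0 := by
    refine integral_eq_zero_of_hasDerivAt_periodic (W := fun s => areaForm (γ 0) (γ s)) e1
      (fun s => ?_) (fun s => by simp only [hγ.closed s])
    refine ((hasDerivAt_const s (γ 0)).areaForm (hc.hasDerivAt_iterate_deriv 0 s)).congr_deriv ?_
    change areaForm 0 _ + areaForm (γ 0) (deriv γ s) = _
    simp [areaForm]
  have h2 : 0 < ∫ s in (0 : ℝ)..L, areaForm (deriv γ s) (γ 0 - γ s) := by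
    refine intervalIntegral.intervalIntegral_pos_of_pos_on (e2.intervalIntegrable _ _)
      (fun s hs => ?_) hγ.period_pos
    have h := areaForm_deriv_chord_pos hγ hs.2 (by linarith [hs.1] : L < s + L)
    have hL : γ L = γ 0 := by simpa using hγ.closed 0
    rwa [hL] at h
  have h3 := intervalIntegral.integral_add (e1.intervalIntegrable (μ := MeasureTheory.volume) 0 L)
    (e2.intervalIntegrable 0 L)
  have h4 : ∫ s in (0 : ℝ)..L, areaForm (γ s) (deriv γ s)
      = ∫ s in (0 : ℝ)..L, (areaForm (γ 0) (deriv γ s) + areaForm (deriv γ s) (γ 0 - γ s)) := by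
    refine intervalIntegral.integral_congr fun s _ => ?_
    simp only [areaForm, Prod.fst_sub, Prod.snd_sub]
    ring
  rw [enclosedArea, h4, h3, h1, zero_add]
  positivity

/-! ### Ellipses and constant equi-affine curvature -/

theorem areaForm_map (M : Plane →ₗ[ℝ] Plane) (v w : Plane) :
    areaForm (M v) (M w) = areaForm (M (1, 0)) (M (0, 1)) * areaForm v w := by
  have h : ∀ v : Plane, M v = v.1 • M (1, 0) + v.2 • M (0, 1) := fun v => by
    rw [← map_smul, ← map_smul, ← map_add]
    congr 1
    ext <;> simp
  rw [h v, h w]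
  simp only [areaForm, Prod.fst_add, Prod.snd_add, Prod.smul_fst, Prod.smul_snd, smul_eq_mul]
  ring

theorem areaForm_map_basis_ne_zero (M : Plane ≃ₗ[ℝ] Plane) :
    areaForm (M (1, 0)) (M (0, 1)) ≠ 0 := fun h => by
  have h1 := areaForm_map M.symm.toLinearMap (M (1, 0)) (M (0, 1))
  rw [h, mul_zero] at h1
  simp [areaForm] at h1

theorem affineEquiv_apply (φ : Plane ≃ᵃ[ℝ] Plane) (w : Plane) : φ w = φ.linear w + φ 0 := by
  have h := φ.map_vadd 0 w
  simpa using h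

theorem exists_cos_sin_eq {a b : ℝ} (h : a ^ 2 + b ^ 2 = 1) :
    ∃ θ : ℝ, a = Real.cos θ ∧ b = Real.sin θ := by
  have hn : ‖(⟨a, b⟩ : ℂ)‖ = 1 := by
    rw [← sq_eq_sq₀ (norm_nonneg _) zero_le_one, Complex.sq_norm, Complex.normSq_mk]
    linarith
  refine ⟨Complex.arg ⟨a, b⟩, ?_, ?_⟩
  · simpa [hn] using (Complex.norm_mul_cos_arg ⟨a, b⟩).symm
  · simpa [hn] using (Complex.norm_mul_sin_arg ⟨a, b⟩).symm

theorem isEllipse_range_of_trigonometric {γ : ℝ → Plane} {p A B : Plane} {ν : ℝ} (hν : ν ≠ 0)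
    (hAB : areaForm A B ≠ 0)
    (h : ∀ s, γ s = p + (Real.cos (ν * s) • A + Real.sin (ν * s) • B)) :
    IsEllipse (range γ) := by
  have hAB' : A.1 * B.2 - A.2 * B.1 ≠ 0 := hAB
  let M : Plane ≃ₗ[ℝ] Plane :=
    { toFun := fun v => v.1 • A + v.2 • B
      invFun := fun w => ((areaForm A B)⁻¹ * areaForm w B, (areaForm A B)⁻¹ * areaForm A w)
      map_add' := fun v w => by simp only [Prod.fst_add, Prod.snd_add, add_smul]; abel
      map_smul' := fun k v => by
        simp only [Prod.smul_fst, Prod.smul_snd, smul_eq_mul, mul_smul, smul_add, RingHom.id_apply]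
      left_inv := fun v => by
        ext <;> simp only [areaForm, Prod.fst_add, Prod.snd_add, Prod.smul_fst, Prod.smul_snd,
          smul_eq_mul] <;> field_simp <;> ring
      right_inv := fun w => by
        ext <;> simp only [areaForm, Prod.fst_add, Prod.snd_add, Prod.smul_fst, Prod.smul_snd,
          smul_eq_mul] <;> field_simp <;> ring }
  refine ⟨M.toAffineEquiv.trans (AffineEquiv.constVAdd ℝ Plane p), ?_⟩
  ext w
  constructor
  · rintro ⟨s, rfl⟩
    exact ⟨(Real.cos (ν * s), Real.sin (ν * s)), Real.cos_sq_add_sin_sq _, (h s).symm⟩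
  · rintro ⟨v, hv, rfl⟩
    obtain ⟨θ, h1, h2⟩ := exists_cos_sin_eq hv
    refine ⟨θ / ν, ?_⟩
    rw [h, mul_div_cancel₀ _ hν, ← h1, ← h2]
    rfl

/-- With `κ = ν²`, the centre `γ + ν⁻² γ''` is constant and the pair `(-ν⁻² γ'', ν⁻¹ γ')` rotates
with angular speed `ν`. -/
theorem isEllipse_of_affineCurvature_const {γ : ℝ → Plane} {L k : ℝ}
    (hγ : IsSimpleClosedPositivelyCurved γ L) (hk : ∀ s, affineCurvature γ s = k) :
    IsEllipse (range γ) := by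
  have hc := hγ.smooth
  have hkpos : 0 < k := hk 0 ▸ hγ.curvature_pos 0
  obtain ⟨ν, hν, rfl⟩ : ∃ ν > 0, k = ν ^ 2 :=
    ⟨√k, Real.sqrt_pos.2 hkpos, (Real.sq_sqrt hkpos.le).symm⟩
  have d0 : ∀ s, HasDerivAt γ (deriv γ s) s := hc.hasDerivAt_iterate_deriv 0
  have d1 : ∀ s, HasDerivAt (deriv γ) (deriv^[2] γ s) s := hc.hasDerivAt_iterate_deriv 1
  have d2 : ∀ s, HasDerivAt (deriv^[2] γ) (-(ν ^ 2 • deriv γ s)) s := fun s => by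
    rw [← hk s, ← deriv_three_of_arcLength hc hγ.arcLength]
    exact hc.hasDerivAt_iterate_deriv 2 s
  set A : Plane := -((ν ^ 2)⁻¹ • deriv^[2] γ 0) with hA
  set B : Plane := ν⁻¹ • deriv γ 0 with hB
  have hθ : ∀ s, HasDerivAt (fun s => ν * s) ν s := fun s => by
    simpa using (hasDerivAt_id s).const_mul ν
  have hcos : ∀ s, HasDerivAt (fun s => Real.cos (ν * s)) (-Real.sin (ν * s) * ν) s := fun s =>
    (hθ s).cos
  have hsin : ∀ s, HasDerivAt (fun s => Real.sin (ν * s)) (Real.cos (ν * s) * ν) s := fun s =>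
    (hθ s).sin
  have hconst : ∀ {f : ℝ → Plane}, (∀ s, HasDerivAt f 0 s) → ∀ s, f s = f 0 := fun h s =>
    is_const_of_deriv_eq_zero (fun s => (h s).differentiableAt) (fun s => (h s).deriv) s 0
  have e1 := hconst (f := fun s => γ s + (ν ^ 2)⁻¹ • deriv^[2] γ s) fun s => by
    refine ((d0 s).add ((d2 s).const_smul (ν ^ 2)⁻¹)).congr_deriv ?_
    rw [smul_neg, inv_smul_smul₀ (by positivity), add_neg_cancel]
  -- `e2` and `e3` undo the rotation of the pair and so give constant vectors.
  have e2 := hconst (f := fun s => Real.cos (ν * s) • -((ν ^ 2)⁻¹ • deriv^[2] γ s)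
      - Real.sin (ν * s) • (ν⁻¹ • deriv γ s)) fun s => by
    refine (((hcos s).smul ((d2 s).const_smul (ν ^ 2)⁻¹).neg).sub
      ((hsin s).smul ((d1 s).const_smul ν⁻¹))).congr_deriv ?_
    ext <;> simp <;> field_simp <;> ring
  have e3 := hconst (f := fun s => Real.sin (ν * s) • -((ν ^ 2)⁻¹ • deriv^[2] γ s)
      + Real.cos (ν * s) • (ν⁻¹ • deriv γ s)) fun s => by
    refine (((hsin s).smul ((d2 s).const_smul (ν ^ 2)⁻¹).neg).add
      ((hcos s).smul ((d1 s).const_smul ν⁻¹))).congr_deriv ?_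
    ext <;> simp <;> field_simp <;> ring
  simp only [mul_zero, Real.cos_zero, Real.sin_zero, one_smul, zero_smul, sub_zero, zero_add]
    at e2 e3
  refine isEllipse_range_of_trigonometric (p := γ 0 + (ν ^ 2)⁻¹ • deriv^[2] γ 0) (A := A) (B := B)
    hν.ne' ?_ fun s => ?_
  · have h1 : areaForm (deriv γ 0) (deriv^[2] γ 0) = 1 := hγ.arcLength 0
    rw [hA, hB, areaForm_neg_left, areaForm_smul_smul, areaForm_swap, h1]
    simp [hν.ne']
  · rw [hA, hB, ← e1 s, ← e2 s, ← e3 s]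
    have hsc := Real.sin_sq_add_cos_sq (ν * s)
    have hs2 : Real.sin (ν * s) ^ 2 = 1 - Real.cos (ν * s) ^ 2 := by linarith
    simp only [smul_add, smul_sub, smul_smul, smul_neg]
    ext <;> simp <;> ring_nf <;> rw [hs2] <;> ring

/-- Transport the curve to the unit circle. There the velocity is `f` times the position turned by a
right angle, and `|T, N| = f³` is the constant determinant. Cubing is injective on the reals, so `f`
is constant whatever its sign. Then `N' = -f² T`, which identifies `κ`. -/
theorem affineCurvature_const_of_isEllipse {γ : ℝ → Plane} {L : ℝ}
    (hγ : IsSimpleClosedPositivelyCurved γ L) (hE : IsEllipse (range γ)) :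
    ∃ k, ∀ s, affineCurvature γ s = k := by
  have hc := hγ.smooth
  obtain ⟨φ, hφ⟩ := hE
  set M : Plane ≃ₗ[ℝ] Plane := φ.symm.linear with hM
  have hMd : ∀ {f : ℝ → Plane} {f' : Plane} {s : ℝ}, HasDerivAt f f' s →
      HasDerivAt (fun s => M (f s)) (M f') s := fun {f f' s} h =>
    (LinearMap.toContinuousLinearMap M.toLinearMap).hasFDerivAt.comp_hasDerivAt s h
  set c : ℝ → Plane := fun s => φ.symm (γ s) with hcdef
  have hcircle : ∀ s, (c s).1 * (c s).1 + (c s).2 * (c s).2 = 1 := fun s => by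
    obtain ⟨v, hv, he⟩ : γ s ∈ φ '' _ := hφ ▸ mem_range_self s
    have hcv : c s = v := by rw [hcdef]; simp only [← he, AffineEquiv.symm_apply_apply]
    rw [hcv, ← sq, ← sq]
    exact hv
  have hfst : ∀ {f : ℝ → Plane} {f' : Plane} {s : ℝ}, HasDerivAt f f' s →
      HasDerivAt (fun s => (f s).1) f'.1 s := fun {f f' s} h =>
    (ContinuousLinearMap.fst ℝ ℝ ℝ).hasFDerivAt.comp_hasDerivAt s h
  have hsnd : ∀ {f : ℝ → Plane} {f' : Plane} {s : ℝ}, HasDerivAt f f' s →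
      HasDerivAt (fun s => (f s).2) f'.2 s := fun {f f' s} h =>
    (ContinuousLinearMap.snd ℝ ℝ ℝ).hasFDerivAt.comp_hasDerivAt s h
  set T : ℝ → Plane := fun s => M (deriv γ s) with hT
  set N : ℝ → Plane := fun s => M (deriv^[2] γ s) with hN
  have d0 : ∀ s, HasDerivAt c (T s) s := fun s => by
    have h := (hMd (hc.hasDerivAt_iterate_deriv 0 s)).add_const (φ.symm 0)
    exact h.congr_of_eventuallyEq (Filter.Eventually.of_forall fun s => affineEquiv_apply φ.symm _)
  have d1 : ∀ s, HasDerivAt T (N s) s := fun s => hMd (hc.hasDerivAt_iterate_deriv 1 s)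
  have d2 : ∀ s, HasDerivAt N (-(affineCurvature γ s • T s)) s := fun s => by
    have h := hMd (hc.hasDerivAt_iterate_deriv 2 s)
    rwa [deriv_three_of_arcLength hc hγ.arcLength, map_neg, map_smul] at h
  have hdet : ∀ s, areaForm (T s) (N s) = areaForm (M (1, 0)) (M (0, 1)) := fun s => by
    have h1 : areaForm (deriv γ s) (deriv^[2] γ s) = 1 := hγ.arcLength s
    have h := areaForm_map M.toLinearMap (deriv γ s) (deriv^[2] γ s)
    rwa [h1, mul_one] at h
  have o1 : ∀ s, (c s).1 * (T s).1 + (c s).2 * (T s).2 = 0 := fun s => by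
    have h := (((hfst (d0 s)).mul (hfst (d0 s))).add ((hsnd (d0 s)).mul (hsnd (d0 s)))).unique
      ((hasDerivAt_const s (1 : ℝ)).congr_of_eventuallyEq (Filter.Eventually.of_forall hcircle))
    linarith
  have o2 : ∀ s, (c s).1 * (N s).1 + (c s).2 * (N s).2
      + ((T s).1 * (T s).1 + (T s).2 * (T s).2) = 0 := fun s => by
    have h := (((hfst (d0 s)).mul (hfst (d1 s))).add ((hsnd (d0 s)).mul (hsnd (d1 s)))).unique
      ((hasDerivAt_const s (0 : ℝ)).congr_of_eventuallyEq (Filter.Eventually.of_forall o1))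
    linarith
  set f : ℝ → ℝ := fun s => (c s).1 * (T s).2 - (c s).2 * (T s).1 with hf
  have t1 : ∀ s, (T s).1 = -(f s * (c s).2) := fun s => by
    simp only [hf]
    linear_combination (c s).1 * o1 s - (T s).1 * hcircle s
  have t2 : ∀ s, (T s).2 = f s * (c s).1 := fun s => by
    simp only [hf]
    linear_combination (c s).2 * o1 s - (T s).2 * hcircle s
  have hcube : ∀ s, f s ^ 3 = areaForm (M (1, 0)) (M (0, 1)) := fun s => by
    rw [← hdet s, areaForm]
    have h2 := o2 s
    rw [t1, t2] at h2 ⊢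
    linear_combination f s * h2 - f s ^ 3 * hcircle s
  have hfc : ∀ s, f s = f 0 := fun s =>
    (Odd.strictMono_pow (by decide : Odd 3)).injective ((hcube s).trans (hcube 0).symm)
  have hne : ∀ s, T s ≠ 0 := fun s h => by
    have h1 := hdet s
    rw [h] at h1
    exact areaForm_map_basis_ne_zero M (by rw [← h1]; simp [areaForm])
  refine ⟨f 0 ^ 2, fun s => ?_⟩
  have n1 : ∀ s, (N s).1 = -(f 0 * (T s).2) := fun s => by
    have h : HasDerivAt (fun s => (T s).1) (-(f 0 * (T s).2)) s :=
      (((hsnd (d0 s)).const_mul (f 0)).neg).congr_of_eventuallyEq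
        (Filter.Eventually.of_forall fun s => by
          simp only [Pi.neg_apply]; rw [t1, hfc])
    exact (hfst (d1 s)).unique h
  have n2 : ∀ s, (N s).2 = f 0 * (T s).1 := fun s => by
    have h : HasDerivAt (fun s => (T s).2) (f 0 * (T s).1) s :=
      ((hfst (d0 s)).const_mul (f 0)).congr_of_eventuallyEq
        (Filter.Eventually.of_forall fun s => by
          simp only; rw [t2, hfc])
    exact (hsnd (d1 s)).unique h
  have k1 : -(affineCurvature γ s * (T s).1) = -(f 0 * (N s).2) := by
    have h : HasDerivAt (fun s => (N s).1) (-(f 0 * (N s).2)) s :=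
      (((hsnd (d1 s)).const_mul (f 0)).neg).congr_of_eventuallyEq
        (Filter.Eventually.of_forall n1)
    exact (hfst (d2 s)).unique h
  have k2 : -(affineCurvature γ s * (T s).2) = f 0 * (N s).1 := by
    have h : HasDerivAt (fun s => (N s).2) (f 0 * (N s).1) s :=
      ((hfst (d1 s)).const_mul (f 0)).congr_of_eventuallyEq (Filter.Eventually.of_forall n2)
    exact (hsnd (d2 s)).unique h
  rw [n2] at k1
  rw [n1] at k2
  have m1 : (affineCurvature γ s - f 0 ^ 2) * (T s).1 = 0 := by linear_combination -k1
  have m2 : (affineCurvature γ s - f 0 ^ 2) * (T s).2 = 0 := by linear_combination -k2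
  by_contra hk
  have hk' : affineCurvature γ s - f 0 ^ 2 ≠ 0 := sub_ne_zero.2 hk
  exact hne s (Prod.ext ((mul_eq_zero.1 m1).resolve_left hk') ((mul_eq_zero.1 m2).resolve_left hk'))

/-! ### Equi-affine parametrisation of a given ellipse. -/

theorem exists_ne_zero_cube_mul_eq_one {δ : ℝ} (hδ : δ ≠ 0) : ∃ ν : ℝ, ν ≠ 0 ∧ ν ^ 3 * δ = 1 := by
  obtain ⟨ν, hν⟩ : ∃ ν : ℝ, ν ^ 3 = δ⁻¹ := by
    rcases hδ.lt_or_gt with h | h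
    · refine ⟨-((-δ⁻¹) ^ (1 / 3 : ℝ)), ?_⟩
      have h1 : ((-δ⁻¹) ^ (1 / 3 : ℝ)) ^ 3 = -δ⁻¹ := by
        rw [← Real.rpow_natCast, ← Real.rpow_mul (by have := inv_lt_zero.2 h; linarith)]
        norm_num
      rw [neg_pow, h1]; ring
    · refine ⟨(δ⁻¹) ^ (1 / 3 : ℝ), ?_⟩
      rw [← Real.rpow_natCast, ← Real.rpow_mul (by positivity)]
      norm_num
  refine ⟨ν, fun h => ?_, by rw [hν, inv_mul_cancel₀ hδ]⟩
  rw [h] at hν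
  exact inv_ne_zero hδ (by rw [← hν]; norm_num)

/-- Running around the circle with angular speed `ν` gives `|γ', γ''| = ν³ det φ`, so `ν` is the
real cube root of `1 / det φ`. It is negative when `φ` reverses orientation, hence the period `2π /
|ν|`. The curvature is `ν²`. -/
theorem IsEllipse.exists_isSimpleClosedPositivelyCurved {E : Set Plane} (hE : IsEllipse E) :
    ∃ (γ : ℝ → Plane) (L : ℝ), IsSimpleClosedPositivelyCurved γ L ∧ range γ = E := by
  obtain ⟨φ, rfl⟩ := hE
  obtain ⟨ν, hν, hν3⟩ := exists_ne_zero_cube_mul_eq_one (areaForm_map_basis_ne_zero φ.linear)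
  set M : Plane →L[ℝ] Plane := LinearMap.toContinuousLinearMap φ.linear.toLinearMap with hM
  have hMa : ∀ v w, areaForm (M v) (M w)
      = areaForm (φ.linear (1, 0)) (φ.linear (0, 1)) * areaForm v w :=
    areaForm_map φ.linear.toLinearMap
  set γ : ℝ → Plane := fun s => φ (Real.cos (ν * s), Real.sin (ν * s)) with hγ
  have hπ := Real.pi_pos
  have hγM : γ = fun s => M (Real.cos (ν * s), Real.sin (ν * s)) + φ 0 :=
    funext fun s => affineEquiv_apply φ _
  have hθ : ∀ s, HasDerivAt (fun s => ν * s) ν s := fun s => by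
    simpa using (hasDerivAt_id s).const_mul ν
  have h1 : deriv γ = fun s => ν • M (-Real.sin (ν * s), Real.cos (ν * s)) := funext fun s => by
    have h : HasDerivAt γ (M (-Real.sin (ν * s) * ν, Real.cos (ν * s) * ν)) s := by
      rw [hγM]
      exact (M.hasFDerivAt.comp_hasDerivAt s ((hθ s).cos.prodMk (hθ s).sin)).add_const _
    rw [h.deriv, ← map_smul]
    congr 1
    ext <;> simp [mul_comm]
  have h2 : deriv^[2] γ = fun s => (-ν ^ 2) • M (Real.cos (ν * s), Real.sin (ν * s)) :=
    funext fun s => by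
      change deriv (deriv γ) s = _
      rw [h1]
      have h := (M.hasFDerivAt.comp_hasDerivAt s ((hθ s).sin.neg.prodMk (hθ s).cos)).const_smul ν
      refine h.deriv.trans ?_
      rw [← map_smul, ← map_smul]
      congr 1
      ext <;> simp <;> ring
  have h3 : ∀ s, deriv^[3] γ s = (-ν ^ 3) • M (-Real.sin (ν * s), Real.cos (ν * s)) := fun s => by
    rw [Function.iterate_succ_apply', h2]
    have h := (M.hasFDerivAt.comp_hasDerivAt s ((hθ s).cos.prodMk (hθ s).sin)).const_smul (-ν ^ 2)
    refine h.deriv.trans ?_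
    rw [← map_smul, ← map_smul]
    congr 1
    ext <;> simp <;> ring
  have harc : ∀ s, areaForm (deriv γ s) (deriv (deriv γ) s) = 1 := fun s => by
    change areaForm (deriv γ s) (deriv^[2] γ s) = 1
    rw [h1, h2, areaForm_smul_smul, hMa]
    simp only [areaForm] at hν3 ⊢
    linear_combination hν3 + ν ^ 3 * ((φ.linear (1, 0)).1 * (φ.linear (0, 1)).2
      - (φ.linear (1, 0)).2 * (φ.linear (0, 1)).1) * Real.sin_sq_add_cos_sq (ν * s)
  refine ⟨γ, 2 * Real.pi / |ν|, ⟨by positivity, ?_, fun s => ?_, ?_, harc, fun s => ?_⟩, ?_⟩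
  · rw [hγM]
    fun_prop
  · rcases abs_cases ν with ⟨h, -⟩ | ⟨h, -⟩
    · have e : ν * (s + 2 * Real.pi / |ν|) = ν * s + 2 * Real.pi := by rw [h]; field_simp
      simp only [hγ, e, Real.cos_add_two_pi, Real.sin_add_two_pi]
    · have e : ν * (s + 2 * Real.pi / |ν|) = ν * s - 2 * Real.pi := by
        rw [h]; field_simp; ring
      simp only [hγ, e, Real.cos_sub_two_pi, Real.sin_sub_two_pi]
  · intro s hs t ht hst
    have h := φ.injective hst
    obtain ⟨hcos, hsin⟩ := Prod.ext_iff.1 h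
    obtain ⟨n, hn⟩ := Real.Angle.angle_eq_iff_two_pi_dvd_sub.1 (Real.Angle.cos_sin_inj hcos hsin)
    have hlt : |s - t| < 2 * Real.pi / |ν| := abs_lt.2 ⟨by linarith [hs.1, ht.2],
      by linarith [hs.2, ht.1]⟩
    rw [lt_div_iff₀ (by positivity), ← abs_mul, mul_comm, mul_sub, hn, abs_mul,
      abs_of_pos (by positivity : 0 < 2 * Real.pi)] at hlt
    have hn1 : |(n : ℝ)| < 1 := by nlinarith
    have hn0 : n = 0 := Int.abs_lt_one_iff.1 (by exact_mod_cast hn1)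
    rw [hn0, Int.cast_zero, mul_zero, ← mul_sub] at hn
    exact sub_eq_zero.1 ((mul_eq_zero.1 hn).resolve_left hν)
  · have hk : affineCurvature γ s = ν ^ 2 := by
      rw [affineCurvature_of_arcLength harc, h2, h3, areaForm_smul_smul, hMa]
      simp only [areaForm] at hν3 ⊢
      linear_combination ν ^ 2 * hν3 + ν ^ 5 * ((φ.linear (1, 0)).1 * (φ.linear (0, 1)).2
        - (φ.linear (1, 0)).2 * (φ.linear (0, 1)).1) * Real.sin_sq_add_cos_sq (ν * s)
    rw [hk]
    positivity
  · ext w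
    constructor
    · rintro ⟨s, rfl⟩
      exact ⟨_, Real.cos_sq_add_sin_sq _, rfl⟩
    · rintro ⟨v, hv, rfl⟩
      obtain ⟨θ, e1, e2⟩ := exists_cos_sin_eq hv
      refine ⟨θ / ν, ?_⟩
      simp only [hγ]
      rw [mul_div_cancel₀ _ hν, ← e1, ← e2]

/-! ### The critical points -/

theorem IsCriticalPoint.isCriticalPointUnder {F G : (ℝ → Plane) → ℝ → ℝ} {γ : ℝ → Plane} {L : ℝ}
    (h : IsCriticalPoint F γ L) : IsCriticalPointUnder F G γ L :=
  fun ε Γ hε hΓ _ => h ε Γ hε hΓ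

theorem isCriticalPoint_of_isEllipse {γ : ℝ → Plane} {L : ℝ}
    (hγ : IsSimpleClosedPositivelyCurved γ L) (hE : IsEllipse (range γ)) :
    IsCriticalPoint fullAffineLength γ L :=
  let ⟨_, hk⟩ := affineCurvature_const_of_isEllipse hγ hE
  isCriticalPoint_of_affineCurvature_const hγ hk

theorem isEllipse_of_hasDerivAt_zero {γ : ℝ → Plane} {L : ℝ}
    (hγ : IsSimpleClosedPositivelyCurved γ L)
    (H : ∀ (ε : ℝ) (Γ : ℝ → ℝ → Plane), 0 < ε → IsDeformation γ L ε Γ →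
      HasDerivAt (fun t => fullAffineLength (Γ t) L) 0 0) : IsEllipse (range γ) :=
  isEllipse_of_affineCurvature_const hγ
    (affineCurvature_const_of_hasDerivAt_zero hγ fun _ ε _ _ hε hΓ => H ε _ hε hΓ)

theorem affineLength_pos {γ : ℝ → Plane} {L : ℝ} (hγ : IsSimpleClosedPositivelyCurved γ L) :
    0 < affineLength γ L :=
  intervalIntegral.intervalIntegral_pos_of_pos_on
    ((contDiff_affineSpeed hγ.smooth fun u => (hγ.arcLength u).symm ▸ one_pos).continuous
      |>.intervalIntegrable _ _)
    (fun u _ => affineSpeed_pos (fun u => (hγ.arcLength u).symm ▸ one_pos) u) hγ.period_pos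

theorem totalAffineCurvature_pos {γ : ℝ → Plane} {L : ℝ}
    (hγ : IsSimpleClosedPositivelyCurved γ L) : 0 < totalAffineCurvature γ L :=
  have hD : ∀ u, 0 < areaForm (deriv γ u) (deriv (deriv γ) u) := fun u =>
    (hγ.arcLength u).symm ▸ one_pos
  intervalIntegral.intervalIntegral_pos_of_pos_on
    (((contDiff_affineCurvature_of_arcLength hγ.smooth hγ.arcLength).continuous.mul
      (contDiff_affineSpeed hγ.smooth hD).continuous).intervalIntegrable _ _)
    (fun u _ => mul_pos (hγ.curvature_pos u) (affineSpeed_pos hD u)) hγ.period_pos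

theorem mainTheorem8 :
    (∀ E : Set Plane, IsEllipse E →
      ∃ (γ : ℝ → Plane) (L : ℝ), IsSimpleClosedPositivelyCurved γ L ∧ range γ = E) ∧
    ∀ (γ : ℝ → Plane) (L : ℝ), IsSimpleClosedPositivelyCurved γ L →
      (IsCriticalPoint fullAffineLength γ L ↔ IsEllipse (range γ)) ∧
      (IsCriticalPointUnder fullAffineLength enclosedArea γ L ↔ IsEllipse (range γ)) ∧
      (IsCriticalPointUnder fullAffineLength affineLength γ L ↔ IsEllipse (range γ)) ∧
      (IsCriticalPointUnder fullAffineLength totalAffineCurvature γ L ↔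
        IsEllipse (range γ)) := by
  refine ⟨fun E hE => hE.exists_isSimpleClosedPositivelyCurved, fun γ L hγ => ?_⟩
  -- Ellipses are critical for all deformations, hence under any constraint; only the converse
  -- directions need the scaling argument.
  have hell := isCriticalPoint_of_isEllipse hγ
  refine ⟨⟨fun h => isEllipse_of_hasDerivAt_zero hγ h, hell⟩,
    ⟨fun h => isEllipse_of_hasDerivAt_zero hγ fun ε Γ hε hΓ => ?_,
      fun h => (hell h).isCriticalPointUnder⟩,
    ⟨fun h => isEllipse_of_hasDerivAt_zero hγ fun ε Γ hε hΓ => ?_,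
      fun h => (hell h).isCriticalPointUnder⟩,
    ⟨fun h => isEllipse_of_hasDerivAt_zero hγ fun ε Γ hε hΓ => ?_,
      fun h => (hell h).isCriticalPointUnder⟩⟩
  · refine h.hasDerivAt_zero (p := 2) (by norm_num) (enclosedArea_pos hγ).ne'
      (fun c k hc _ _ => ?_) hε hΓ hΓ.contDiffOn_enclosedArea
    rw [enclosedArea_const_smul hc]
    norm_cast
  · exact h.hasDerivAt_zero (p := 2 / 3) (by norm_num) (affineLength_pos hγ).ne'
      (fun c k hc hD hk => affineLength_const_smul hc hk hD L) hε hΓ hΓ.contDiffOn_affineLength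
  · exact h.hasDerivAt_zero (p := -(2 / 3)) (by norm_num) (totalAffineCurvature_pos hγ).ne'
      (fun c k hc hD hk => totalAffineCurvature_const_smul hc hk hD L) hε hΓ
      hΓ.contDiffOn_totalAffineCurvature
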